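/- Let $\Gamma$ be a non-empty set. A commutative ternary $\Gamma$-semiring (with identity) is a commutative additive monoid $(T,+,0)$ with an element $1\in T$ and operations $(a,b,c)\mapsto\{a,b,c\}_\gamma$ ($\gamma\in\Gamma$) that are additive in each variable and satisfy $\{a,b,\{c,d,e\}_\gamma\}_\delta=\{\{a,b,c\}_\gamma,d,e\}_\delta$, $\{a,0,b\}_\gamma=0$, $\{a,b,c\}_\gamma=\{b,a,c\}_\gamma$ and $\{1,1,a\}_\gamma=\{1,a,1\}_\gamma=\{a,1,1\}_\gamma=a$. Homomorphisms preserve $+$, $0$, $1$ and every $\{\cdot,\cdot,\cdot\}_\gamma$. A $\Gamma$-ideal is a subset containing $0$, closed under addition, and containing $\{a,b,c\}_\gamma$ whenever it contains one of $a,b,c$. A $\Gamma$-ideal $P\neq T$ is prime if $\{a,b,c\}_\gamma\in P$ implies $a\in P$ or $b\in P$ or $c\in P$. $\mathrm{Spec}_\Gamma T$ is the set of prime $\Gamma$-ideals, with closed sets $V(I)=\{P: I\subseteq P\}$ for $\Gamma$-ideals $I$. $T_P$ is the set of fractions $a/s$ ($a\in T$, $s\notin P$), where $a/s=b/t$ iff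 there is $u\notin P$ with $\{u,a,t\}_\gamma=\{u,b,s\}_\gamma$ for all $\gamma$, with $a/s+b/t=(\{a,t,t\}_\gamma+\{b,s,t\}_\gamma)/\{s,t,t\}_\gamma$ (independent of $\gamma$) and componentwise ternary products. $\mathcal O(U)$ is the set of families $(s(P))_{P\in U}$, $s(P)\in T_P$, that are near each point of the form $Q\mapsto a/b$ with fixed $a,b\in T$, $b\notin Q$. A locally $\Gamma$-semiringed space is a topological space with a sheaf of commutative ternary $\Gamma$-semirings whose stalks each have a unique maximal $\Gamma$-ideal; its morphisms are continuous maps together with pullback homomorphisms of sections, compatible with restriction, for which the induced homomorphisms of stalks reflect invertibility of elements. $\mathbf{Aff}_\Gamma$ is the full subcategory of those spaces isomorphic to $(\mathrm{Spec}_\Gamma T,\mathcal O)$ for some $T$. **Theorem.** (1) *(Functoriality)* $T\mapsto(\mathrm{Spec}_\Gamma T,\mathcal O)$, together with $f\mapsto \mathrm{Spec}_\Gamma f$, where for $f:T\to T'$ the morphism $\mathrm{Spec}_\Gamma f:\mathrm{Spec}_\Gamma T'\to\mathrm{Spec}_\Gamma T$ is $P'\mapsto f^{-1}(P')$ on points and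 is induced on sections by the homomorphisms $T_{f^{-1}(P')}\to T'_{P'}$, $a/s\mapsto f(a)/f(s)$, is a contravariant functor from commutative ternary $\Gamma$-semirings to $\mathbf{Aff}_\Gamma$. (2) *(Adjunction)* Regarding $\mathrm{Spec}_\Gamma$ as a functor from commutative ternary $\Gamma$-semirings to $\mathbf{Aff}_\Gamma^{\mathrm{op}}$, the global sections functor $X\mapsto\mathcal O_X(X)$ from $\mathbf{Aff}_\Gamma^{\mathrm{op}}$ to commutative ternary $\Gamma$-semirings is right adjoint to it, with unit the canonical homomorphisms $\lambda_T: T\to\mathcal O(\mathrm{Spec}_\Gamma T)$, $a\mapsto(P\mapsto a/1)$. (3) For all $T,T'$ the map $\varphi\mapsto\mathrm{Spec}_\Gamma\varphi$ is a bijection $\mathrm{Hom}(T',T)\to\mathrm{Hom}_{\mathbf{Aff}_\Gamma}(\mathrm{Spec}_\Gamma T,\mathrm{Spec}_\Gamma T')$. Its inverse is given by pullback of global sections: it sends $\psi$ to a homomorphism $\varphi$ with $\psi^{*}\circ\lambda_{T'}=\lambda_T\circ\varphi$, where $\psi^{*}$ is the pullback of global sections along $\psi$. -/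

import Mathlib

open CategoryTheory Opposite TopologicalSpace AlgebraicGeometry

universe v u

set_option linter.style.haveILetI false
set_option linter.unusedSectionVars false

namespace GammaGeometry

noncomputable section

/-! ## Ternary semirings with parameters -/

/-- A ternary `Γ`-semiring structure on an additive commutative monoid `T`:
`tri γ a b c` is the product `{a, b, c}_γ`. -/
class TernaryGammaSemiring (Γ : Type v) (T : Type u) [AddCommMonoid T] where
  tri : Γ → T → T → T → T
  add_tri : ∀ γ a b c d, tri γ (a + b) c d = tri γ a c d + tri γ b c d
  tri_add_mid : ∀ γ a b c d, tri γ c (a + b) d = tri γ c a d + tri γ c b d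
  tri_add : ∀ γ a b c d, tri γ c d (a + b) = tri γ c d a + tri γ c d b
  tri_assoc : ∀ γ δ a b c d e, tri δ a b (tri γ c d e) = tri δ (tri γ a b c) d e
  tri_zero_mid : ∀ γ a b, tri γ a 0 b = 0

/-- A commutative ternary `Γ`-semiring with an identity element `1`. -/
class CommTernaryGammaSemiring (Γ : Type v) (T : Type u) [AddCommMonoid T] [One T]
    extends TernaryGammaSemiring Γ T where
  tri_comm : ∀ γ a b c, tri γ a b c = tri γ b a c
  one_one_tri : ∀ γ a, tri γ 1 1 a = a
  one_tri_one : ∀ γ a, tri γ 1 a 1 = a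
  tri_one_one : ∀ γ a, tri γ a 1 1 = a

open TernaryGammaSemiring CommTernaryGammaSemiring

section Basic

variable {Γ : Type v} [Nonempty Γ] {T : Type u} [AddCommMonoid T] [One T]
  [CommTernaryGammaSemiring Γ T]

theorem tri_one_right (γ : Γ) (a b : T) : tri γ a b 1 = tri γ a 1 b := by
  have h := tri_assoc γ γ a 1 1 b 1
  rwa [one_tri_one, tri_one_one, eq_comm] at h

theorem tri_split (γ δ : Γ) (a b c : T) : tri γ a b c = tri δ (tri δ a b 1) c 1 := by
  have h : tri γ a b c = tri δ a b c := by
    have h := tri_assoc γ δ 1 1 a b c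
    rwa [one_one_tri, one_one_tri] at h
  rw [h, tri_one_right δ _ c, ← tri_assoc, one_one_tri]

variable (Γ T) in
/-- The binary product `(a, b) ↦ {a, b, 1}_γ`; an auxiliary device for the computations below. -/
abbrev asCommSemiring : CommSemiring T :=
  { (inferInstance : AddCommMonoid T), (inferInstance : One T) with
    mul := fun a b => tri (Classical.arbitrary Γ) a b 1
    left_distrib := fun a b c => by
      change tri _ a (b + c) 1 = tri _ a b 1 + tri _ a c 1
      exact tri_add_mid _ _ _ _ _
    right_distrib := fun a b c => by
      change tri _ (a + b) c 1 = tri _ a c 1 + tri _ b c 1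
      exact add_tri _ _ _ _ _
    zero_mul := fun a => by
      change tri _ 0 a 1 = 0
      rw [tri_comm, tri_zero_mid]
    mul_zero := fun a => by
      change tri _ a 0 1 = 0
      rw [tri_zero_mid]
    mul_assoc := fun a b c => by
      change tri _ (tri _ a b 1) c 1 = tri _ a (tri _ b c 1) 1
      rw [tri_one_right _ a (tri _ b c 1), tri_assoc, tri_one_right _ a b]
    one_mul := fun a => one_tri_one _ a
    mul_one := fun a => tri_one_one _ a
    mul_comm := fun a b => tri_comm _ a b 1 }

variable (Γ T) in
theorem tri_eq_mul (γ : Γ) (a b c : T) :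
    letI := asCommSemiring Γ T
    tri γ a b c = a * b * c :=
  tri_split _ _ _ _ _

end Basic

/-! ## Homomorphisms and the category of commutative ternary `Γ`-semirings -/

/-- Homomorphisms of commutative ternary `Γ`-semirings with identity. -/
@[ext]
structure GammaHom (Γ : Type v) (T T' : Type u) [AddCommMonoid T] [One T]
    [CommTernaryGammaSemiring Γ T] [AddCommMonoid T'] [One T'] [CommTernaryGammaSemiring Γ T'] where
  toFun : T → T'
  map_zero' : toFun 0 = 0
  map_one' : toFun 1 = 1
  map_add' : ∀ a b, toFun (a + b) = toFun a + toFun b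
  map_tri' : ∀ (γ : Γ) (a b c : T), toFun (tri γ a b c) = tri γ (toFun a) (toFun b) (toFun c)

namespace GammaHom

variable {Γ : Type v} {T T' T'' : Type u} [AddCommMonoid T] [One T]
    [CommTernaryGammaSemiring Γ T] [AddCommMonoid T'] [One T'] [CommTernaryGammaSemiring Γ T']
    [AddCommMonoid T''] [One T''] [CommTernaryGammaSemiring Γ T'']

instance : FunLike (GammaHom Γ T T') T T' where
  coe := toFun
  coe_injective := fun _ _ h => GammaHom.ext h

@[ext]
theorem hom_ext {f g : GammaHom Γ T T'} (h : ∀ a, f a = g a) : f = g := DFunLike.ext _ _ h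

theorem map_zero (f : GammaHom Γ T T') : f 0 = 0 := f.map_zero'
theorem map_one (f : GammaHom Γ T T') : f 1 = 1 := f.map_one'
theorem map_add (f : GammaHom Γ T T') (a b : T) : f (a + b) = f a + f b := f.map_add' a b
theorem map_tri (f : GammaHom Γ T T') (γ : Γ) (a b c : T) :
    f (tri γ a b c) = tri γ (f a) (f b) (f c) := f.map_tri' γ a b c

/-- The identity homomorphism. -/
def id (Γ : Type v) (T : Type u) [AddCommMonoid T] [One T] [CommTernaryGammaSemiring Γ T] :
    GammaHom Γ T T :=
  ⟨fun a => a, rfl, rfl, fun _ _ => rfl, fun _ _ _ _ => rfl⟩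

/-- Composition of homomorphisms. -/
def comp (g : GammaHom Γ T' T'') (f : GammaHom Γ T T') : GammaHom Γ T T'' where
  toFun a := g (f a)
  map_zero' := by rw [f.map_zero, g.map_zero]
  map_one' := by rw [f.map_one, g.map_one]
  map_add' a b := by rw [f.map_add, g.map_add]
  map_tri' γ a b c := by rw [f.map_tri, g.map_tri]

end GammaHom

/-- The category of commutative ternary `Γ`-semirings with identity. -/
structure TGSemi (Γ : Type v) where
  of (Γ) ::
  carrier : Type u
  [addCommMonoid : AddCommMonoid carrier]
  [one : One carrier]
  [str : CommTernaryGammaSemiring Γ carrier]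

namespace TGSemi

instance (Γ : Type v) : CoeSort (TGSemi.{v, u} Γ) (Type u) := ⟨carrier⟩

attribute [instance] addCommMonoid one str

variable {Γ : Type v}

/-- Morphisms in the category of commutative ternary `Γ`-semirings. -/
@[ext]
structure Hom (A B : TGSemi.{v, u} Γ) where
  hom' : GammaHom Γ A B

instance : Category (TGSemi.{v, u} Γ) where
  Hom A B := Hom A B
  id A := ⟨GammaHom.id Γ A⟩
  comp f g := ⟨g.hom'.comp f.hom'⟩

instance : ConcreteCategory (TGSemi.{v, u} Γ) (fun A B => GammaHom Γ A B) where
  hom := Hom.hom'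
  ofHom := Hom.mk

/-- The homomorphism underlying a morphism. -/
abbrev Hom.hom {A B : TGSemi.{v, u} Γ} (f : A ⟶ B) : GammaHom Γ A B :=
  ConcreteCategory.hom f

/-- A homomorphism as a morphism in the category. -/
abbrev ofHom {A B : TGSemi.{v, u} Γ} (f : GammaHom Γ A B) : A ⟶ B := ConcreteCategory.ofHom f

theorem ext_hom {A B : TGSemi.{v, u} Γ} {f g : A ⟶ B} (h : ∀ a : A, f a = g a) : f = g :=
  ConcreteCategory.hom_ext _ _ h

theorem comp_app {A B C : TGSemi.{v, u} Γ} (f : A ⟶ B) (g : B ⟶ C) (a : A) :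
    (f ≫ g) a = g (f a) := rfl

theorem id_app {A : TGSemi.{v, u} Γ} (a : A) : (𝟙 A : A ⟶ A) a = a := rfl

theorem map_zero {A B : TGSemi.{v, u} Γ} (f : A ⟶ B) : f 0 = 0 := f.hom.map_zero
theorem map_one {A B : TGSemi.{v, u} Γ} (f : A ⟶ B) : f 1 = 1 := f.hom.map_one
theorem map_add {A B : TGSemi.{v, u} Γ} (f : A ⟶ B) (a b : A) : f (a + b) = f a + f b :=
  f.hom.map_add a b
theorem map_tri {A B : TGSemi.{v, u} Γ} (f : A ⟶ B) (γ : Γ) (a b c : A) :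
    f (tri γ a b c) = tri γ (f a) (f b) (f c) := f.hom.map_tri γ a b c

end TGSemi

/-! ## Ideals, units, local semirings -/

/-- `Γ`-ideals. -/
@[ext]
structure GammaIdeal (Γ : Type v) (T : Type u) [AddCommMonoid T] [TernaryGammaSemiring Γ T] where
  carrier : Set T
  zero_mem : (0 : T) ∈ carrier
  add_mem : ∀ a b, a ∈ carrier → b ∈ carrier → a + b ∈ carrier
  tri_mem_left : ∀ (γ : Γ) a b c, a ∈ carrier → tri γ a b c ∈ carrier
  tri_mem_mid : ∀ (γ : Γ) a b c, a ∈ carrier → tri γ b a c ∈ carrier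
  tri_mem_right : ∀ (γ : Γ) a b c, a ∈ carrier → tri γ b c a ∈ carrier

/-- A `Γ`-ideal is proper if it is not the whole semiring. -/
def GammaIdeal.IsProper {Γ : Type v} {T : Type u} [AddCommMonoid T] [TernaryGammaSemiring Γ T]
    (I : GammaIdeal Γ T) : Prop := I.carrier ≠ Set.univ

/-- Maximal `Γ`-ideals: maximal among the proper ones. -/
def GammaIdeal.IsMaximal {Γ : Type v} {T : Type u} [AddCommMonoid T] [TernaryGammaSemiring Γ T]
    (I : GammaIdeal Γ T) : Prop :=
  I.IsProper ∧ ∀ J : GammaIdeal Γ T, J.IsProper → I.carrier ⊆ J.carrier → J = I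

/-- A commutative ternary `Γ`-semiring is local if it has a unique maximal `Γ`-ideal. -/
def IsLocalGamma (Γ : Type v) (T : Type u) [AddCommMonoid T] [TernaryGammaSemiring Γ T] : Prop :=
  ∃! I : GammaIdeal Γ T, I.IsMaximal

/-- Invertible elements. -/
def IsInvertible (Γ : Type v) {T : Type u} [AddCommMonoid T] [One T]
    [CommTernaryGammaSemiring Γ T] (a : T) : Prop :=
  ∃ b : T, ∀ γ : Γ, tri γ a b 1 = 1

/-- Local homomorphisms: those that reflect invertibility. -/
def GammaHom.IsLocal {Γ : Type v} {T T' : Type u} [AddCommMonoid T] [One T]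
    [CommTernaryGammaSemiring Γ T] [AddCommMonoid T'] [One T'] [CommTernaryGammaSemiring Γ T']
    (f : GammaHom Γ T T') : Prop :=
  ∀ a, IsInvertible Γ (f a) → IsInvertible Γ a

section Units

variable {Γ : Type v} {T T' : Type u} [AddCommMonoid T] [One T]
    [CommTernaryGammaSemiring Γ T] [AddCommMonoid T'] [One T'] [CommTernaryGammaSemiring Γ T']

theorem IsInvertible.map (f : GammaHom Γ T T') {a : T} (h : IsInvertible Γ a) :
    IsInvertible Γ (f a) := by
  obtain ⟨b, hb⟩ := h
  exact ⟨f b, fun γ => by rw [← f.map_one, ← f.map_tri, hb]⟩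

theorem isInvertible_one : IsInvertible Γ (1 : T) := ⟨1, fun γ => one_one_tri γ 1⟩

theorem isInvertible_iff_mul [Nonempty Γ] (a : T) :
    letI := asCommSemiring Γ T
    IsInvertible Γ a ↔ ∃ b, a * b = 1 := by
  letI := asCommSemiring Γ T
  constructor
  · rintro ⟨b, hb⟩
    refine ⟨b, ?_⟩
    have := hb (Classical.arbitrary Γ)
    rwa [tri_eq_mul, mul_one] at this
  · rintro ⟨b, hb⟩
    exact ⟨b, fun γ => by rw [tri_eq_mul, mul_one, hb]⟩

theorem IsInvertible.of_tri [Nonempty Γ] {γ : Γ} {a b c : T}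
    (h : IsInvertible Γ (tri γ a b c)) :
    IsInvertible Γ a ∧ IsInvertible Γ b ∧ IsInvertible Γ c := by
  letI := asCommSemiring Γ T
  rw [isInvertible_iff_mul] at h
  obtain ⟨d, hd⟩ := h
  rw [tri_eq_mul] at hd
  refine ⟨(isInvertible_iff_mul _).2 ⟨b * c * d, ?_⟩, (isInvertible_iff_mul _).2 ⟨a * c * d, ?_⟩,
    (isInvertible_iff_mul _).2 ⟨a * b * d, ?_⟩⟩ <;> rw [← hd] <;> ring

/-- If the non-invertible elements are closed under addition and `0` is not invertible, then
the semiring is local. -/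
theorem isLocalGamma_of_nonunits [Nonempty Γ] (h0 : ¬ IsInvertible Γ (0 : T))
    (hadd : ∀ a b : T, IsInvertible Γ (a + b) → IsInvertible Γ a ∨ IsInvertible Γ b) :
    IsLocalGamma Γ T := by
  let M : GammaIdeal Γ T :=
    { carrier := {a | ¬ IsInvertible Γ a}
      zero_mem := h0
      add_mem := fun a b ha hb h => (hadd a b h).elim ha hb
      tri_mem_left := fun γ a b c ha h => ha h.of_tri.1
      tri_mem_mid := fun γ a b c ha h => ha h.of_tri.2.1
      tri_mem_right := fun γ a b c ha h => ha h.of_tri.2.2 }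
  have hM : M.IsProper := fun h => by
    have : (1 : T) ∈ M.carrier := by rw [h]; trivial
    exact this isInvertible_one
  have hle : ∀ J : GammaIdeal Γ T, J.IsProper → J.carrier ⊆ M.carrier := by
    intro J hJ a ha hinv
    apply hJ
    obtain ⟨b, hb⟩ := hinv
    apply Set.eq_univ_of_forall
    intro x
    let γ : Γ := Classical.arbitrary Γ
    have h1 : (1 : T) ∈ J.carrier := by
      rw [← hb γ]; exact J.tri_mem_left _ _ _ _ ha
    rw [← tri_one_one γ x]
    exact J.tri_mem_mid _ _ _ _ h1
  refine ⟨M, ⟨hM, fun J hJ hMJ => GammaIdeal.ext ((hle J hJ).antisymm hMJ)⟩, ?_⟩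
  intro J hJ
  exact (hJ.2 M hM (hle J hJ.1)).symm

theorem isLocalGamma_of_isLocal {f : GammaHom Γ T T'} (hf : f.IsLocal)
    (h0 : ¬ IsInvertible Γ (0 : T'))
    (hadd : ∀ a b : T', IsInvertible Γ (a + b) → IsInvertible Γ a ∨ IsInvertible Γ b)
    [Nonempty Γ] : IsLocalGamma Γ T := by
  apply isLocalGamma_of_nonunits
  · intro h
    exact h0 (f.map_zero ▸ h.map f)
  · intro a b h
    have := h.map f
    rw [f.map_add] at this
    exact (hadd _ _ this).imp (hf a) (hf b)

end Units

/-! ## Localization -/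

/-- Multiplicative systems. -/
structure MulSystem (Γ : Type v) (T : Type u) [AddCommMonoid T] [One T]
    [TernaryGammaSemiring Γ T] where
  carrier : Set T
  zero_notMem : (0 : T) ∉ carrier
  one_mem : (1 : T) ∈ carrier
  tri_mem : ∀ (γ : Γ) a b c, a ∈ carrier → b ∈ carrier → c ∈ carrier → tri γ a b c ∈ carrier

section Localization

variable {Γ : Type v} [Nonempty Γ] {T : Type u} [AddCommMonoid T] [One T]
  [CommTernaryGammaSemiring Γ T] (S : MulSystem Γ T)

theorem MulSystem.mul_mem {s t : T} (hs : s ∈ S.carrier) (ht : t ∈ S.carrier) :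
    letI := asCommSemiring Γ T
    s * t ∈ S.carrier :=
  S.tri_mem _ _ _ _ hs ht S.one_mem

/-- The relation `(a, s) ∼ (b, t)` on numerator-denominator pairs. -/
def locRel (x y : T × S.carrier) : Prop :=
  ∃ w ∈ S.carrier, ∀ γ : Γ, tri γ w x.1 y.2 = tri γ w y.1 x.2

theorem locRel_iff (x y : T × S.carrier) :
    letI := asCommSemiring Γ T
    locRel S x y ↔ ∃ w ∈ S.carrier, w * x.1 * y.2 = w * y.1 * x.2 := by
  letI := asCommSemiring Γ T
  constructor
  · rintro ⟨w, hw, h⟩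
    refine ⟨w, hw, ?_⟩
    have := h (Classical.arbitrary Γ)
    rwa [tri_eq_mul, tri_eq_mul] at this
  · rintro ⟨w, hw, h⟩
    exact ⟨w, hw, fun γ => by rw [tri_eq_mul, tri_eq_mul, h]⟩

/-- `∼` is an equivalence relation. -/
def locSetoid : Setoid (T × S.carrier) where
  r := locRel S
  iseqv :=
    { refl := fun x => ⟨1, S.one_mem, fun _ => rfl⟩
      symm := fun ⟨w, hw, h⟩ => ⟨w, hw, fun γ => (h γ).symm⟩
      trans := by
        intro x y z hxy hyz
        letI := asCommSemiring Γ T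
        rw [locRel_iff] at hxy hyz ⊢
        obtain ⟨w, hw, h⟩ := hxy
        obtain ⟨w', hw', h'⟩ := hyz
        refine ⟨w * w' * y.2, S.mul_mem (S.mul_mem hw hw') y.2.2, ?_⟩
        calc w * w' * (y.2 : T) * x.1 * z.2 = (w * x.1 * y.2) * (w' * z.2) := by ring
          _ = (w' * y.1 * z.2) * (w * x.2) := by rw [h]; ring
          _ = w * w' * (y.2 : T) * z.1 * x.2 := by rw [h']; ring }

/-- The localization `S⁻¹T`. -/
def Loc : Type u := Quotient (locSetoid S)

namespace Loc

variable {S}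

/-- The fraction `a / s`. -/
def mk (a : T) (s : S.carrier) : Loc S := Quotient.mk (locSetoid S) (a, s)

theorem mk_eq_mk {a b : T} {s t : S.carrier} :
    letI := asCommSemiring Γ T
    mk a s = mk b t ↔ ∃ w ∈ S.carrier, w * a * t = w * b * s :=
  (Quotient.eq (r := locSetoid S)).trans (locRel_iff S _ _)

theorem ind {p : Loc S → Prop} (h : ∀ a s, p (mk a s)) (x : Loc S) : p x :=
  Quotient.inductionOn x fun y => h y.1 y.2

/-- The ternary product of three denominators. -/
def triDen (γ : Γ) (s t r : S.carrier) : S.carrier :=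
  ⟨tri γ (s : T) t r, S.tri_mem γ _ _ _ s.2 t.2 r.2⟩

/-- Addition of fractions,
`a / s + b / t = ({a, t, t}_γ + {b, s, t}_γ) / {s, t, t}_γ`; by `mk_add_mk` below the choice
of `γ` does not matter. -/
instance : Add (Loc S) where
  add := Quotient.map₂
    (fun x y => (tri (Classical.arbitrary Γ) x.1 (y.2 : T) y.2 +
        tri (Classical.arbitrary Γ) y.1 (x.2 : T) y.2,
      triDen (Classical.arbitrary Γ) x.2 y.2 y.2))
    (by
      rintro ⟨a, s⟩ ⟨a', s'⟩ h ⟨b, t⟩ ⟨b', t'⟩ k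
      letI := asCommSemiring Γ T
      replace h := (locRel_iff S _ _).1 h
      replace k := (locRel_iff S _ _).1 k
      refine (locRel_iff S _ _).2 ?_
      obtain ⟨w, hw, h⟩ := h
      obtain ⟨w', hw', k⟩ := k
      refine ⟨w * w', S.mul_mem hw hw', ?_⟩
      dsimp only at h k
      simp only [triDen, tri_eq_mul]
      calc w * w' * (a * t * t + b * s * t) * ((s' : T) * t' * t')
          = (w * a * s') * (w' * t * t * t' * t') + (w' * b * t') * (w * s * s' * t * t') := by ring
        _ = w * w' * (a' * t' * t' + b' * s' * t') * ((s : T) * t * t) := by rw [h, k]; ring)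

/-- The componentwise ternary product of fractions,
`{a / s, b / t, c / r}_γ = {a, b, c}_γ / {s, t, r}_γ`. -/
def triLoc (γ : Γ) (x y z : Loc S) : Loc S :=
  Quotient.liftOn x
    (fun x => Quotient.map₂ (sc := locSetoid S)
      (fun y z => (tri γ x.1 y.1 z.1, triDen γ x.2 y.2 z.2))
      (by
        rintro ⟨b, t⟩ ⟨b', t'⟩ h ⟨c, r⟩ ⟨c', r'⟩ k
        obtain ⟨a, s⟩ := x
        letI := asCommSemiring Γ T
        replace h := (locRel_iff S _ _).1 h
        replace k := (locRel_iff S _ _).1 k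
        refine (locRel_iff S _ _).2 ?_
        obtain ⟨w, hw, h⟩ := h
        obtain ⟨w', hw', k⟩ := k
        refine ⟨w * w', S.mul_mem hw hw', ?_⟩
        dsimp only at h k
        simp only [triDen, tri_eq_mul]
        calc w * w' * (a * b * c) * ((s : T) * t' * r')
            = (w * b * t') * (w' * c * r') * (a * s) := by ring
          _ = w * w' * (a * b' * c') * ((s : T) * t * r) := by rw [h, k]; ring) y z)
    (by
      rintro ⟨a, s⟩ ⟨a', s'⟩ h
      letI := asCommSemiring Γ T
      induction y using Quotient.inductionOn
      induction z using Quotient.inductionOn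
      rename_i y z
      obtain ⟨b, t⟩ := y
      obtain ⟨c, r⟩ := z
      refine Quotient.sound (s := locSetoid S) ?_
      replace h := (locRel_iff S _ _).1 h
      refine (locRel_iff S _ _).2 ?_
      obtain ⟨w, hw, h⟩ := h
      refine ⟨w, hw, ?_⟩
      dsimp only at h
      simp only [triDen, tri_eq_mul]
      calc w * (a * b * c) * ((s' : T) * t * r)
          = (w * a * s') * (b * c * t * r) := by ring
        _ = w * (a' * b * c) * ((s : T) * t * r) := by rw [h]; ring)

theorem triLoc_mk (γ : Γ) (a b c : T) (s t r : S.carrier) :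
    triLoc γ (mk a s) (mk b t) (mk c r) = mk (tri γ a b c) (triDen γ s t r) := rfl

theorem mk_add_mk (γ : Γ) (a b : T) (s t : S.carrier) :
    mk a s + mk b t = mk (tri γ a (t : T) t + tri γ b (s : T) t) (triDen γ s t t) := by
  change mk (tri (Classical.arbitrary Γ) a (t : T) t + tri (Classical.arbitrary Γ) b (s : T) t)
    (triDen (Classical.arbitrary Γ) s t t) = _
  letI := asCommSemiring Γ T
  simp only [triDen, tri_eq_mul]

instance : Zero (Loc S) := ⟨mk 0 ⟨1, S.one_mem⟩⟩

instance : One (Loc S) := ⟨mk 1 ⟨1, S.one_mem⟩⟩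

theorem zero_def : (0 : Loc S) = mk 0 ⟨1, S.one_mem⟩ := rfl

theorem one_def : (1 : Loc S) = mk 1 ⟨1, S.one_mem⟩ := rfl

theorem mk_add_mk' (a b : T) (s t : S.carrier) :
    letI := asCommSemiring Γ T
    mk a s + mk b t = mk (a * t + b * s) ⟨s * t, S.mul_mem s.2 t.2⟩ := by
  letI := asCommSemiring Γ T
  rw [mk_add_mk (Classical.arbitrary Γ), mk_eq_mk]
  refine ⟨1, S.one_mem, ?_⟩
  simp only [triDen, tri_eq_mul]
  ring

theorem mk_congr {a b : T} {s t : S.carrier}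
    (h : letI := asCommSemiring Γ T; a * t = b * s) : mk a s = mk b t := by
  letI := asCommSemiring Γ T
  rw [mk_eq_mk]
  exact ⟨1, S.one_mem, by rw [one_mul, one_mul, h]⟩

instance : AddCommMonoid (Loc S) where
  add_assoc x y z := by
    letI := asCommSemiring Γ T
    induction x using ind; induction y using ind; induction z using ind
    simp only [mk_add_mk']
    apply mk_congr
    simp only
    ring
  zero_add x := by
    letI := asCommSemiring Γ T
    induction x using ind
    simp only [mk_add_mk', zero_def]
    apply mk_congr
    simp only
    ring
  add_zero x := by
    letI := asCommSemiring Γ T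
    induction x using ind
    simp only [mk_add_mk', zero_def]
    apply mk_congr
    simp only
    ring
  add_comm x y := by
    letI := asCommSemiring Γ T
    induction x using ind; induction y using ind
    simp only [mk_add_mk']
    apply mk_congr
    simp only
    ring
  nsmul := nsmulRec

instance : CommTernaryGammaSemiring Γ (Loc S) where
  tri := triLoc
  add_tri γ x y z w := by
    letI := asCommSemiring Γ T
    induction x using ind; induction y using ind; induction z using ind; induction w using ind
    simp only [mk_add_mk', triLoc_mk, triDen, tri_eq_mul]
    apply mk_congr
    simp only
    ring
  tri_add_mid γ x y z w := by
    letI := asCommSemiring Γ T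
    induction x using ind; induction y using ind; induction z using ind; induction w using ind
    simp only [mk_add_mk', triLoc_mk, triDen, tri_eq_mul]
    apply mk_congr
    simp only
    ring
  tri_add γ x y z w := by
    letI := asCommSemiring Γ T
    induction x using ind; induction y using ind; induction z using ind; induction w using ind
    simp only [mk_add_mk', triLoc_mk, triDen, tri_eq_mul]
    apply mk_congr
    simp only
    ring
  tri_assoc γ δ x y z p q := by
    letI := asCommSemiring Γ T
    induction x using ind; induction y using ind; induction z using ind
    induction p using ind; induction q using ind
    simp only [triLoc_mk, triDen, tri_eq_mul]
    apply mk_congr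
    simp only
    ring
  tri_zero_mid γ x y := by
    letI := asCommSemiring Γ T
    induction x using ind; induction y using ind
    simp only [zero_def, triLoc_mk, triDen, tri_eq_mul]
    apply mk_congr
    simp only
    ring
  tri_comm γ x y z := by
    letI := asCommSemiring Γ T
    induction x using ind; induction y using ind; induction z using ind
    simp only [triLoc_mk, triDen, tri_eq_mul]
    apply mk_congr
    simp only
    ring
  one_one_tri γ x := by
    letI := asCommSemiring Γ T
    induction x using ind
    simp only [one_def, triLoc_mk, triDen, tri_eq_mul]
    apply mk_congr
    simp only
    ring
  one_tri_one γ x := by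
    letI := asCommSemiring Γ T
    induction x using ind
    simp only [one_def, triLoc_mk, triDen, tri_eq_mul]
    apply mk_congr
    simp only
    ring
  tri_one_one γ x := by
    letI := asCommSemiring Γ T
    induction x using ind
    simp only [one_def, triLoc_mk, triDen, tri_eq_mul]
    apply mk_congr
    simp only
    ring

theorem tri_mk (γ : Γ) (a b c : T) (s t r : S.carrier) :
    tri γ (mk a s) (mk b t) (mk c r) = mk (tri γ a b c) (triDen γ s t r) := rfl

/-- The canonical homomorphism `T → S⁻¹T`, `a ↦ a / 1`. -/
def toLoc (S : MulSystem Γ T) : GammaHom Γ T (Loc S) where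
  toFun a := mk a ⟨1, S.one_mem⟩
  map_zero' := rfl
  map_one' := rfl
  map_add' a b := by
    letI := asCommSemiring Γ T
    rw [mk_add_mk']
    apply mk_congr
    simp only
    ring
  map_tri' γ a b c := by
    letI := asCommSemiring Γ T
    rw [tri_mk]
    apply mk_congr
    simp only [triDen, tri_eq_mul]
    ring

/-- The homomorphism of localizations `a / s ↦ f a / f s` induced by a homomorphism `f` that
maps denominators to denominators. -/
def map {T' : Type u} [AddCommMonoid T'] [One T'] [CommTernaryGammaSemiring Γ T']
    {S : MulSystem Γ T} {S' : MulSystem Γ T'} (f : GammaHom Γ T T')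
    (h : ∀ s ∈ S.carrier, f s ∈ S'.carrier) : GammaHom Γ (Loc S) (Loc S') where
  toFun := Quotient.lift (fun x : T × S.carrier => mk (f x.1) ⟨f x.2, h _ x.2.2⟩) (by
    rintro ⟨a, s⟩ ⟨b, t⟩ ⟨w, hw, e⟩
    refine Quotient.sound (s := locSetoid S') ⟨f w, h w hw, fun γ => ?_⟩
    have := congrArg f (e γ)
    rwa [f.map_tri, f.map_tri] at this)
  map_zero' := by
    change mk (f 0) ⟨f 1, _⟩ = _
    simp only [f.map_zero, f.map_one]
    rfl
  map_one' := by
    change mk (f 1) ⟨f 1, _⟩ = _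
    simp only [f.map_one]
    rfl
  map_add' x y := by
    induction x using ind; induction y using ind
    rename_i a s b t
    change Quotient.lift _ _ (mk a s + mk b t) = mk (f a) ⟨f s, _⟩ + mk (f b) ⟨f t, _⟩
    rw [mk_add_mk (Classical.arbitrary Γ), mk_add_mk (Classical.arbitrary Γ)]
    change mk (f _) ⟨f _, _⟩ = _
    simp only [triDen, f.map_add, f.map_tri]
  map_tri' γ x y z := by
    induction x using ind; induction y using ind; induction z using ind
    rename_i a s b t c r
    change mk (f _) ⟨f _, _⟩ = mk _ _
    simp only [triDen, f.map_tri]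

theorem map_mk {T' : Type u} [AddCommMonoid T'] [One T'] [CommTernaryGammaSemiring Γ T']
    {S : MulSystem Γ T} {S' : MulSystem Γ T'} (f : GammaHom Γ T T')
    (h : ∀ s ∈ S.carrier, f s ∈ S'.carrier) (a : T) (s : S.carrier) :
    map f h (mk a s) = mk (f a) ⟨f s, h _ s.2⟩ := rfl

end Loc

end Localization

/-! ## The prime spectrum -/

/-- The prime spectrum: prime `Γ`-ideals. -/
@[ext]
structure PrimeSpec (Γ : Type v) (T : Type u) [AddCommMonoid T] [TernaryGammaSemiring Γ T] where
  ideal : GammaIdeal Γ T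
  proper : ideal.IsProper
  prime : ∀ (γ : Γ) a b c, tri γ a b c ∈ ideal.carrier →
    a ∈ ideal.carrier ∨ b ∈ ideal.carrier ∨ c ∈ ideal.carrier

namespace PrimeSpec

section Topology

variable {Γ : Type v} [Nonempty Γ] {T : Type u} [AddCommMonoid T] [One T]
  [CommTernaryGammaSemiring Γ T]

/-- The set `V(I)` of primes containing `I`. -/
def zeroLocus (I : GammaIdeal Γ T) : Set (PrimeSpec Γ T) :=
  {P | I.carrier ⊆ P.ideal.carrier}

/-- The `Γ`-ideal generated by a set. -/
def idealSpan (s : Set T) : GammaIdeal Γ T where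
  carrier := {a | ∀ J : GammaIdeal Γ T, s ⊆ J.carrier → a ∈ J.carrier}
  zero_mem J _ := J.zero_mem
  add_mem a b ha hb J h := J.add_mem a b (ha J h) (hb J h)
  tri_mem_left γ a b c ha J h := J.tri_mem_left γ a b c (ha J h)
  tri_mem_mid γ a b c ha J h := J.tri_mem_mid γ a b c (ha J h)
  tri_mem_right γ a b c ha J h := J.tri_mem_right γ a b c (ha J h)

theorem idealSpan_subset_iff (s : Set T) (J : GammaIdeal Γ T) :
    (idealSpan (Γ := Γ) s).carrier ⊆ J.carrier ↔ s ⊆ J.carrier :=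
  ⟨fun h _ ha => h fun _ hJ => hJ ha, fun h _ ha => ha J h⟩

/-- The intersection of two `Γ`-ideals. -/
def idealInter (I J : GammaIdeal Γ T) : GammaIdeal Γ T where
  carrier := I.carrier ∩ J.carrier
  zero_mem := ⟨I.zero_mem, J.zero_mem⟩
  add_mem a b ha hb := ⟨I.add_mem a b ha.1 hb.1, J.add_mem a b ha.2 hb.2⟩
  tri_mem_left γ a b c ha := ⟨I.tri_mem_left γ a b c ha.1, J.tri_mem_left γ a b c ha.2⟩
  tri_mem_mid γ a b c ha := ⟨I.tri_mem_mid γ a b c ha.1, J.tri_mem_mid γ a b c ha.2⟩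
  tri_mem_right γ a b c ha := ⟨I.tri_mem_right γ a b c ha.1, J.tri_mem_right γ a b c ha.2⟩

/-- The Zariski topology: the closed sets are the sets `V(I)`, `I` a `Γ`-ideal. -/
instance : TopologicalSpace (PrimeSpec Γ T) where
  IsOpen U := ∃ I : GammaIdeal Γ T, Uᶜ = zeroLocus I
  isOpen_univ := by
    refine ⟨idealSpan Set.univ, ?_⟩
    rw [Set.compl_univ, eq_comm, Set.eq_empty_iff_forall_notMem]
    intro P hP
    exact P.proper (Set.univ_subset_iff.1 ((idealSpan_subset_iff _ _).1 hP))
  isOpen_inter := by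
    rintro U V ⟨I, hI⟩ ⟨J, hJ⟩
    refine ⟨idealInter I J, ?_⟩
    rw [Set.compl_inter, hI, hJ]
    ext P
    constructor
    · rintro (h | h) a ha
      · exact h ha.1
      · exact h ha.2
    · intro h
      by_contra hn
      rw [Set.mem_union, not_or] at hn
      obtain ⟨a, ha, haP⟩ := Set.not_subset.1 hn.1
      obtain ⟨b, hb, hbP⟩ := Set.not_subset.1 hn.2
      have h1 := h (a := tri (Classical.arbitrary Γ) a a b)
        ⟨I.tri_mem_left _ _ _ _ ha, J.tri_mem_right _ _ _ _ hb⟩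
      rcases P.prime _ _ _ _ h1 with h2 | h2 | h2
      · exact haP h2
      · exact haP h2
      · exact hbP h2
  isOpen_sUnion := by
    intro s hs
    refine ⟨idealSpan {a | ∃ U ∈ s, ∃ I : GammaIdeal Γ T, Uᶜ = zeroLocus I ∧ a ∈ I.carrier}, ?_⟩
    ext P
    rw [zeroLocus, Set.mem_ofPred_eq, idealSpan_subset_iff, Set.mem_compl_iff, Set.mem_sUnion]
    constructor
    · rintro h a ⟨U, hU, I, hI, ha⟩
      have hP : P ∈ Uᶜ := fun hPU => h ⟨U, hU, hPU⟩
      rw [hI] at hP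
      exact hP ha
    · rintro h ⟨U, hU, hPU⟩
      obtain ⟨I, hI⟩ := hs U hU
      have : P ∈ Uᶜ := by
        rw [hI]
        exact fun a ha => h ⟨U, hU, I, hI, ha⟩
      exact this hPU

theorem isOpen_basic (a : T) : IsOpen {P : PrimeSpec Γ T | a ∉ P.ideal.carrier} := by
  refine ⟨idealSpan {a}, ?_⟩
  ext P
  rw [zeroLocus, Set.mem_ofPred_eq, idealSpan_subset_iff]
  simp

theorem one_notMem (P : PrimeSpec Γ T) : (1 : T) ∉ P.ideal.carrier := by
  intro h
  apply P.proper
  refine Set.eq_univ_of_forall fun x => ?_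
  rw [← tri_one_one (Classical.arbitrary Γ) x]
  exact P.ideal.tri_mem_mid _ _ _ _ h

/-- The multiplicative system `T ∖ P`. -/
def compl (P : PrimeSpec Γ T) : MulSystem Γ T where
  carrier := P.ideal.carrierᶜ
  zero_notMem h := h P.ideal.zero_mem
  one_mem := P.one_notMem
  tri_mem γ a b c ha hb hc h := by
    rcases P.prime γ a b c h with h | h | h
    exacts [ha h, hb h, hc h]

/-- The localization `T_P` of `T` at the prime `P`. -/
abbrev AtPrime (P : PrimeSpec Γ T) : Type u := Loc P.compl

/-- The fraction `a / b` in `T_P`, for `b ∉ P`. -/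
def frac (P : PrimeSpec Γ T) (a b : T) (hb : b ∉ P.ideal.carrier) : P.AtPrime :=
  Loc.mk a (⟨b, hb⟩ : P.compl.carrier)

theorem isInvertible_mk_iff (P : PrimeSpec Γ T) (a : T) (s : P.compl.carrier) :
    IsInvertible Γ (Loc.mk a s : P.AtPrime) ↔ a ∉ P.ideal.carrier := by
  letI := asCommSemiring Γ T
  constructor
  · rintro ⟨b, hb⟩ ha
    have := hb (Classical.arbitrary Γ)
    induction b using Loc.ind with | _ b t => ?_
    rw [Loc.one_def, Loc.tri_mk, Loc.mk_eq_mk] at this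
    obtain ⟨w, hw, h⟩ := this
    have h1 : tri (Classical.arbitrary Γ) w (tri (Classical.arbitrary Γ) a b 1) 1 ∈
        P.ideal.carrier := P.ideal.tri_mem_mid _ _ _ _ (P.ideal.tri_mem_left _ _ _ _ ha)
    rw [tri_eq_mul, h, mul_one] at h1
    exact P.compl.mul_mem hw (Loc.triDen _ s t ⟨1, P.compl.one_mem⟩).2 h1
  · intro ha
    refine ⟨Loc.mk s ⟨a, ha⟩, fun γ => ?_⟩
    rw [Loc.one_def, Loc.tri_mk]
    apply Loc.mk_congr
    simp only [Loc.triDen, tri_eq_mul]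
    ring

theorem not_isInvertible_zero (P : PrimeSpec Γ T) : ¬ IsInvertible Γ (0 : P.AtPrime) := by
  rw [Loc.zero_def, isInvertible_mk_iff, not_not]
  exact P.ideal.zero_mem

theorem isInvertible_add (P : PrimeSpec Γ T) (x y : P.AtPrime)
    (h : IsInvertible Γ (x + y)) : IsInvertible Γ x ∨ IsInvertible Γ y := by
  induction x using Loc.ind with | _ a s => ?_
  induction y using Loc.ind with | _ b t => ?_
  rw [Loc.mk_add_mk (Classical.arbitrary Γ), isInvertible_mk_iff] at h
  rw [isInvertible_mk_iff, isInvertible_mk_iff]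
  by_contra hn
  rw [not_or, not_not, not_not] at hn
  exact h (P.ideal.add_mem _ _ (P.ideal.tri_mem_left _ _ _ _ hn.1)
    (P.ideal.tri_mem_left _ _ _ _ hn.2))

end Topology

section Comap

variable {Γ : Type v} [Nonempty Γ] {T T' : Type u} [AddCommMonoid T] [One T]
  [CommTernaryGammaSemiring Γ T] [AddCommMonoid T'] [One T'] [CommTernaryGammaSemiring Γ T']

/-- The map `P ↦ f⁻¹(P)` on prime spectra. -/
def comap (f : GammaHom Γ T T') (P : PrimeSpec Γ T') : PrimeSpec Γ T where
  ideal :=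
    { carrier := f ⁻¹' P.ideal.carrier
      zero_mem := by rw [Set.mem_preimage, f.map_zero]; exact P.ideal.zero_mem
      add_mem := fun a b ha hb => by
        rw [Set.mem_preimage, f.map_add]; exact P.ideal.add_mem _ _ ha hb
      tri_mem_left := fun γ a b c ha => by
        rw [Set.mem_preimage, f.map_tri]; exact P.ideal.tri_mem_left _ _ _ _ ha
      tri_mem_mid := fun γ a b c ha => by
        rw [Set.mem_preimage, f.map_tri]; exact P.ideal.tri_mem_mid _ _ _ _ ha
      tri_mem_right := fun γ a b c ha => by
        rw [Set.mem_preimage, f.map_tri]; exact P.ideal.tri_mem_right _ _ _ _ ha }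
  proper h := by
    have h1 : (1 : T) ∈ f ⁻¹' P.ideal.carrier := (Set.ext_iff.1 h 1).2 trivial
    rw [Set.mem_preimage, f.map_one] at h1
    exact P.one_notMem h1
  prime γ a b c h := by
    rw [Set.mem_preimage, f.map_tri] at h
    exact P.prime γ _ _ _ h

theorem continuous_comap (f : GammaHom Γ T T') : Continuous (comap f) := by
  refine ⟨fun U ⟨I, hI⟩ => ⟨idealSpan (f '' I.carrier), ?_⟩⟩
  ext P
  rw [← Set.preimage_compl, hI]
  change _ ↔ (idealSpan (f '' I.carrier)).carrier ⊆ P.ideal.carrier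
  rw [idealSpan_subset_iff, Set.image_subset_iff]
  rfl

/-- The local homomorphism `T_{f⁻¹(P)} → T'_P`, `a / s ↦ f a / f s`. -/
def localMap (f : GammaHom Γ T T') (P : PrimeSpec Γ T') :
    GammaHom Γ (comap f P).AtPrime P.AtPrime :=
  Loc.map f fun _ hs => hs

end Comap

end PrimeSpec

/-! ## The structure sheaf -/

section StructureSheaf

variable (Γ : Type v) [Nonempty Γ] (T : Type u) [AddCommMonoid T] [One T]
  [CommTernaryGammaSemiring Γ T]

/-- The prime spectrum as a topological space. -/
def specTop : TopCat.{u} := TopCat.of (PrimeSpec Γ T)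

variable {Γ T} in
/-- The point of the prime spectrum as a prime ideal. -/
abbrev asPrime (P : specTop Γ T) : PrimeSpec Γ T := P

/-- The family of localizations at the points of the spectrum. -/
abbrev Fibre (P : specTop Γ T) : Type u := (asPrime P).AtPrime

/-- A family of germs is a fraction on `U` if it is of the form `Q ↦ a / b` in `T_Q` for fixed
`a`, `b` with `b ∉ Q` for all `Q ∈ U`. -/
def isFractionPrelocal : TopCat.PrelocalPredicate (Fibre Γ T) where
  pred {U} f := ∃ a b : T, ∀ Q : U, ∃ hb : b ∉ (asPrime Q.1).ideal.carrier,
    f Q = (asPrime Q.1).frac a b hb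
  res := by
    rintro V U i f ⟨a, b, h⟩
    exact ⟨a, b, fun Q => h (i Q)⟩

/-- The families of germs that are, on a neighbourhood of each point, a fraction. -/
def isLocallyFraction : TopCat.LocalPredicate (Fibre Γ T) := (isFractionPrelocal Γ T).sheafify

/-- The sections of the structure sheaf over `U`. -/
def sectionsSub (U : Opens (specTop Γ T)) : AddSubmonoid (∀ P : U, Fibre Γ T P.1) where
  carrier := {f | (isLocallyFraction Γ T).pred f}
  zero_mem' P := ⟨U, P.2, 𝟙 _, 0, 1, fun Q => ⟨(asPrime Q.1).one_notMem, rfl⟩⟩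
  add_mem' {f g} hf hg P := by
    obtain ⟨V, hV, i, a, s, hf⟩ := hf P
    obtain ⟨W, hW, j, b, t, hg⟩ := hg P
    refine ⟨V ⊓ W, ⟨hV, hW⟩, Opens.infLELeft _ _ ≫ i,
      tri (Classical.arbitrary Γ) a t t + tri (Classical.arbitrary Γ) b s t,
      tri (Classical.arbitrary Γ) s t t, fun Q => ?_⟩
    obtain ⟨hs, hf⟩ := hf ⟨Q.1, Q.2.1⟩
    obtain ⟨ht, hg⟩ := hg ⟨Q.1, Q.2.2⟩
    exact ⟨(asPrime Q.1).compl.tri_mem _ _ _ _ hs ht ht,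
      (congrArg₂ (· + ·) hf hg).trans (Loc.mk_add_mk _ _ _ _ _)⟩

instance (U : Opens (specTop Γ T)) : One (sectionsSub Γ T U) :=
  ⟨⟨fun _ => 1, fun P => ⟨U, P.2, 𝟙 _, 1, 1, fun Q => ⟨(asPrime Q.1).one_notMem, rfl⟩⟩⟩⟩

/-- The pointwise ternary product of sections. -/
def sectionsTri (U : Opens (specTop Γ T)) (γ : Γ) (f g h : sectionsSub Γ T U) :
    sectionsSub Γ T U :=
  ⟨fun P => tri γ (f.1 P) (g.1 P) (h.1 P), fun P => by
    obtain ⟨V, hV, i, a, s, hf⟩ := f.2 P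
    obtain ⟨W, hW, j, b, t, hg⟩ := g.2 P
    obtain ⟨X, hX, k, c, r, hh⟩ := h.2 P
    refine ⟨V ⊓ W ⊓ X, ⟨⟨hV, hW⟩, hX⟩, Opens.infLELeft _ _ ≫ Opens.infLELeft _ _ ≫ i,
      tri γ a b c, tri γ s t r, fun Q => ?_⟩
    obtain ⟨hs, hf⟩ := hf ⟨Q.1, Q.2.1.1⟩
    obtain ⟨ht, hg⟩ := hg ⟨Q.1, Q.2.1.2⟩
    obtain ⟨hr, hh⟩ := hh ⟨Q.1, Q.2.2⟩
    refine ⟨(asPrime Q.1).compl.tri_mem _ _ _ _ hs ht hr, ?_⟩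
    dsimp only at hf hg hh ⊢
    change f.1 (i ⟨Q.1, Q.2.1.1⟩) = _ at hf
    change g.1 (j ⟨Q.1, Q.2.1.2⟩) = _ at hg
    change h.1 (k ⟨Q.1, Q.2.2⟩) = _ at hh
    change tri γ (f.1 (i ⟨Q.1, Q.2.1.1⟩)) (g.1 (j ⟨Q.1, Q.2.1.2⟩)) (h.1 (k ⟨Q.1, Q.2.2⟩)) = _
    rw [hf, hg, hh]
    exact Loc.tri_mk γ a b c (S := (asPrime Q.1).compl) ⟨s, hs⟩ ⟨t, ht⟩ ⟨r, hr⟩⟩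

instance (U : Opens (specTop Γ T)) : CommTernaryGammaSemiring Γ (sectionsSub Γ T U) where
  tri := sectionsTri Γ T U
  add_tri γ _ _ _ _ := Subtype.ext (funext fun _ => add_tri γ _ _ _ _)
  tri_add_mid γ _ _ _ _ := Subtype.ext (funext fun _ => tri_add_mid γ _ _ _ _)
  tri_add γ _ _ _ _ := Subtype.ext (funext fun _ => tri_add γ _ _ _ _)
  tri_assoc γ δ _ _ _ _ _ := Subtype.ext (funext fun _ => tri_assoc γ δ _ _ _ _ _)
  tri_zero_mid γ _ _ := Subtype.ext (funext fun _ => tri_zero_mid γ _ _)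
  tri_comm γ _ _ _ := Subtype.ext (funext fun _ => tri_comm γ _ _ _)
  one_one_tri γ _ := Subtype.ext (funext fun _ => one_one_tri γ _)
  one_tri_one γ _ := Subtype.ext (funext fun _ => one_tri_one γ _)
  tri_one_one γ _ := Subtype.ext (funext fun _ => tri_one_one γ _)

/-- The structure presheaf `U ↦ {locally fractional families of germs on U}`, with restriction
of functions. -/
def structurePresheaf : TopCat.Presheaf (TGSemi.{v, u} Γ) (specTop Γ T) where
  obj U := TGSemi.of Γ (sectionsSub Γ T U.unop)
  map {U V} i := TGSemi.ofHom (A := TGSemi.of Γ (sectionsSub Γ T U.unop))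
      (B := TGSemi.of Γ (sectionsSub Γ T V.unop))
    { toFun := fun f => ⟨fun P => f.1 (i.unop P), (isLocallyFraction Γ T).res i.unop f.1 f.2⟩
      map_zero' := rfl
      map_one' := rfl
      map_add' := fun _ _ => rfl
      map_tri' := fun _ _ _ _ => rfl }
  map_id _ := rfl
  map_comp _ _ := rfl

end StructureSheaf

/-- A presheaf of commutative ternary `Γ`-semirings is a sheaf as soon as the underlying presheaf
of sets is one. -/
theorem isSheaf_of_forget {Γ : Type v} {X : TopCat.{u}}
    (F : TopCat.Presheaf (TGSemi.{v, u} Γ) X)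
    (h : TopCat.Presheaf.IsSheaf (F ⋙ forget (TGSemi.{v, u} Γ))) : F.IsSheaf := by
  have : Limits.ReflectsLimitsOfSize.{u, u} (forget (TGSemi.{v, u} Γ)) := by
    refine ⟨fun {J} _ => ⟨fun {K} => ⟨fun {c} hc => ?_⟩⟩⟩
    have key : ∀ x y : c.pt, (∀ j, c.π.app j x = c.π.app j y) → x = y := by
      intro x y hxy
      apply (Limits.Types.isLimitEquivSections hc).injective
      refine Subtype.ext (funext fun j => ?_)
      exact hxy j
    have hl : ∀ (s : Limits.Cone K) (j : J) (x : s.pt),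
        c.π.app j (hc.lift ((forget _).mapCone s) x) = s.π.app j x := fun s j x =>
      ConcreteCategory.congr_hom (hc.fac ((forget _).mapCone s) j) x
    refine ⟨⟨fun s => TGSemi.ofHom
      { toFun := hc.lift ((forget _).mapCone s)
        map_zero' := key _ _ fun j => by rw [hl, TGSemi.map_zero, TGSemi.map_zero]
        map_one' := key _ _ fun j => by rw [hl, TGSemi.map_one, TGSemi.map_one]
        map_add' := fun a b => key _ _ fun j => by
          rw [hl, TGSemi.map_add, TGSemi.map_add, hl, hl]
        map_tri' := fun γ a b c => key _ _ fun j => by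
          rw [hl, TGSemi.map_tri, TGSemi.map_tri, hl, hl, hl] }, ?_, ?_⟩⟩
    · intro s j
      exact TGSemi.ext_hom fun x => hl s j x
    · intro s m hm
      refine TGSemi.ext_hom fun x => key _ _ fun j => ?_
      refine Eq.trans ?_ (hl s j x).symm
      rw [← hm j]
      rfl
  exact CategoryTheory.Presheaf.isSheaf_of_isSheaf_comp _ _ (forget (TGSemi.{v, u} Γ)) h

theorem structurePresheaf_isSheaf (Γ : Type v) [Nonempty Γ] (T : Type u) [AddCommMonoid T] [One T]
    [CommTernaryGammaSemiring Γ T] : (structurePresheaf Γ T).IsSheaf :=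
  isSheaf_of_forget _ (TopCat.subpresheafToTypes.isSheaf (isLocallyFraction Γ T))

/-! ## Stalks -/

section Stalk

variable {Γ : Type v} {X : TopCat.{u}} (F : TopCat.Presheaf (TGSemi.{v, u} Γ) X)

/-- Restriction of sections. -/
def res {U V : Opens X} (h : V ≤ U) (s : F.obj (op U)) : F.obj (op V) := F.map (homOfLE h).op s

theorem res_zero {U V : Opens X} (h : V ≤ U) : res F h 0 = 0 := TGSemi.map_zero _

theorem res_one {U V : Opens X} (h : V ≤ U) : res F h 1 = 1 := TGSemi.map_one _

theorem res_add {U V : Opens X} (h : V ≤ U) (s t : F.obj (op U)) :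
    res F h (s + t) = res F h s + res F h t := TGSemi.map_add _ _ _

theorem res_tri {U V : Opens X} (h : V ≤ U) (γ : Γ) (s t w : F.obj (op U)) :
    res F h (tri γ s t w) = tri γ (res F h s) (res F h t) (res F h w) := TGSemi.map_tri _ _ _ _ _

theorem res_res {U V W : Opens X} (h : V ≤ U) (k : W ≤ V) (s : F.obj (op U)) :
    res F k (res F h s) = res F (k.trans h) s := by
  have : (homOfLE (k.trans h)).op = (homOfLE h).op ≫ (homOfLE k).op := rfl
  rw [res, res, res, this, F.map_comp]
  rfl

/-- A section over an open neighbourhood of `x`. -/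
structure GermRep (x : X) where
  U : Opens X
  mem : x ∈ U
  s : F.obj (op U)

/-- Sections near `x` are equivalent if they agree on a smaller neighbourhood of `x`. -/
def germSetoid (x : X) : Setoid (GermRep F x) where
  r a b := ∃ (W : Opens X) (_ : x ∈ W) (h : W ≤ a.U) (k : W ≤ b.U), res F h a.s = res F k b.s
  iseqv :=
    { refl := fun a => ⟨a.U, a.mem, le_rfl, le_rfl, rfl⟩
      symm := fun ⟨W, hx, h, k, e⟩ => ⟨W, hx, k, h, e.symm⟩
      trans := by
        rintro a b c ⟨W, hx, h, k, e⟩ ⟨W', hx', h', k', e'⟩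
        refine ⟨W ⊓ W', ⟨hx, hx'⟩, inf_le_left.trans h, inf_le_right.trans k', ?_⟩
        rw [← res_res F h inf_le_left, e, res_res, ← res_res F k' inf_le_right, ← e', res_res] }

/-- The stalk at `x`. -/
def Stalk (x : X) : Type u := Quotient (germSetoid F x)

/-- The germ at `x` of a section. -/
def germ (x : X) (U : Opens X) (hx : x ∈ U) (s : F.obj (op U)) : Stalk F x :=
  Quotient.mk (germSetoid F x) ⟨U, hx, s⟩

variable {F}

theorem germ_eq_iff {x : X} {U V : Opens X} {hU : x ∈ U} {hV : x ∈ V} {s : F.obj (op U)}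
    {t : F.obj (op V)} :
    germ F x U hU s = germ F x V hV t ↔
      ∃ (W : Opens X) (_ : x ∈ W) (h : W ≤ U) (k : W ≤ V), res F h s = res F k t :=
  Quotient.eq (r := germSetoid F x)

theorem germ_res {x : X} {U V : Opens X} (hV : x ∈ V) (h : V ≤ U) (s : F.obj (op U)) :
    germ F x U (h hV) s = germ F x V hV (res F h s) :=
  germ_eq_iff.2 ⟨V, hV, h, le_rfl, (res_res F h le_rfl s).symm⟩

theorem germ_exists {x : X} (q : Stalk F x) :
    ∃ (U : Opens X) (hx : x ∈ U) (s : F.obj (op U)), q = germ F x U hx s :=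
  Quotient.inductionOn q fun a => ⟨a.U, a.mem, a.s, rfl⟩

theorem germ_exists₂ {x : X} (p q : Stalk F x) :
    ∃ (U : Opens X) (hx : x ∈ U) (s t : F.obj (op U)), p = germ F x U hx s ∧
      q = germ F x U hx t := by
  obtain ⟨U, hU, s, rfl⟩ := germ_exists p
  obtain ⟨V, hV, t, rfl⟩ := germ_exists q
  exact ⟨U ⊓ V, ⟨hU, hV⟩, res F inf_le_left s, res F inf_le_right t,
    germ_res (V := U ⊓ V) ⟨hU, hV⟩ inf_le_left _, germ_res (V := U ⊓ V) ⟨hU, hV⟩ inf_le_right _⟩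

theorem germ_exists₃ {x : X} (p q r : Stalk F x) :
    ∃ (U : Opens X) (hx : x ∈ U) (s t w : F.obj (op U)), p = germ F x U hx s ∧
      q = germ F x U hx t ∧ r = germ F x U hx w := by
  obtain ⟨U, hU, s, t, rfl, rfl⟩ := germ_exists₂ p q
  obtain ⟨V, hV, w, rfl⟩ := germ_exists r
  exact ⟨U ⊓ V, ⟨hU, hV⟩, res F inf_le_left s, res F inf_le_left t, res F inf_le_right w,
    germ_res (V := U ⊓ V) ⟨hU, hV⟩ inf_le_left _, germ_res (V := U ⊓ V) ⟨hU, hV⟩ inf_le_left _,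
    germ_res (V := U ⊓ V) ⟨hU, hV⟩ inf_le_right _⟩

theorem germ_exists₅ {x : X} (p q r p' q' : Stalk F x) :
    ∃ (U : Opens X) (hx : x ∈ U) (s t w s' t' : F.obj (op U)), p = germ F x U hx s ∧
      q = germ F x U hx t ∧ r = germ F x U hx w ∧ p' = germ F x U hx s' ∧
      q' = germ F x U hx t' := by
  obtain ⟨U, hU, s, t, w, rfl, rfl, rfl⟩ := germ_exists₃ p q r
  obtain ⟨V, hV, s', t', rfl, rfl⟩ := germ_exists₂ p' q'
  exact ⟨U ⊓ V, ⟨hU, hV⟩, res F inf_le_left s, res F inf_le_left t, res F inf_le_left w,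
    res F inf_le_right s', res F inf_le_right t',
    germ_res (V := U ⊓ V) ⟨hU, hV⟩ inf_le_left _, germ_res (V := U ⊓ V) ⟨hU, hV⟩ inf_le_left _,
    germ_res (V := U ⊓ V) ⟨hU, hV⟩ inf_le_left _, germ_res (V := U ⊓ V) ⟨hU, hV⟩ inf_le_right _,
    germ_res (V := U ⊓ V) ⟨hU, hV⟩ inf_le_right _⟩

instance (x : X) : Zero (Stalk F x) := ⟨germ F x ⊤ trivial 0⟩

instance (x : X) : One (Stalk F x) := ⟨germ F x ⊤ trivial 1⟩

/-- Addition of germs: restrict to a common neighbourhood and add. -/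
instance (x : X) : Add (Stalk F x) where
  add := Quotient.map₂
    (fun a b => ⟨a.U ⊓ b.U, ⟨a.mem, b.mem⟩, res F inf_le_left a.s + res F inf_le_right b.s⟩)
    (by
      rintro a a' ⟨W, hx, h, k, e⟩ b b' ⟨W', hx', h', k', e'⟩
      refine ⟨W ⊓ W', ⟨hx, hx'⟩, inf_le_inf h h', inf_le_inf k k', ?_⟩
      dsimp only
      rw [res_add, res_add]
      have e1 := congrArg (res F (inf_le_left : W ⊓ W' ≤ W)) e
      have e2 := congrArg (res F (inf_le_right : W ⊓ W' ≤ W')) e'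
      rw [res_res, res_res] at e1 e2
      exact congrArg₂ (· + ·) (by rw [res_res, res_res]; exact e1)
        (by rw [res_res, res_res]; exact e2))

/-- The ternary product of germs: restrict to a common neighbourhood and multiply. -/
def stalkTri (x : X) (γ : Γ) (p q r : Stalk F x) : Stalk F x :=
  Quotient.liftOn p
    (fun a => Quotient.map₂ (sc := germSetoid F x)
      (fun b c => ⟨a.U ⊓ (b.U ⊓ c.U), ⟨a.mem, b.mem, c.mem⟩,
        tri γ (res F inf_le_left a.s) (res F (inf_le_right.trans inf_le_left) b.s)
          (res F (inf_le_right.trans inf_le_right) c.s)⟩)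
      (by
        rintro b b' ⟨W, hx, h, k, e⟩ c c' ⟨W', hx', h', k', e'⟩
        refine ⟨a.U ⊓ (W ⊓ W'), ⟨a.mem, hx, hx'⟩, inf_le_inf le_rfl (inf_le_inf h h'),
          inf_le_inf le_rfl (inf_le_inf k k'), ?_⟩
        dsimp only
        rw [res_tri, res_tri]
        have e1 := congrArg (res F (inf_le_right.trans inf_le_left : a.U ⊓ (W ⊓ W') ≤ W)) e
        have e2 := congrArg (res F (inf_le_right.trans inf_le_right : a.U ⊓ (W ⊓ W') ≤ W')) e'
        rw [res_res, res_res] at e1 e2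
        congr 1
        · rw [res_res, res_res]
        · rw [res_res, res_res]; exact e1
        · rw [res_res, res_res]; exact e2) q r)
    (by
      rintro a a' ⟨W, hx, h, k, e⟩
      induction q using Quotient.inductionOn
      induction r using Quotient.inductionOn
      rename_i b c
      refine Quotient.sound (s := germSetoid F x) ⟨W ⊓ (b.U ⊓ c.U), ⟨hx, b.mem, c.mem⟩,
        inf_le_inf h le_rfl, inf_le_inf k le_rfl, ?_⟩
      dsimp only
      rw [res_tri, res_tri]
      have e1 := congrArg (res F (inf_le_left : W ⊓ (b.U ⊓ c.U) ≤ W)) e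
      rw [res_res, res_res] at e1
      congr 1
      · rw [res_res, res_res]; exact e1
      · rw [res_res, res_res]
      · rw [res_res, res_res])

theorem germ_zero (x : X) (U : Opens X) (hx : x ∈ U) : germ F x U hx 0 = 0 := by
  refine germ_eq_iff.2 ⟨U, hx, le_rfl, le_top, ?_⟩
  rw [res_zero, res_zero]

theorem germ_one (x : X) (U : Opens X) (hx : x ∈ U) : germ F x U hx 1 = 1 := by
  refine germ_eq_iff.2 ⟨U, hx, le_rfl, le_top, ?_⟩
  rw [res_one, res_one]

theorem germ_add (x : X) (U : Opens X) (hx : x ∈ U) (s t : F.obj (op U)) :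
    germ F x U hx s + germ F x U hx t = germ F x U hx (s + t) := by
  refine germ_eq_iff.2 ⟨U, hx, le_inf le_rfl le_rfl, le_rfl, ?_⟩
  dsimp only
  rw [res_add, res_add]
  exact congrArg₂ (· + ·) (res_res _ _ _ _) (res_res _ _ _ _)

theorem stalkTri_germ (x : X) (γ : Γ) (U : Opens X) (hx : x ∈ U) (s t w : F.obj (op U)) :
    stalkTri x γ (germ F x U hx s) (germ F x U hx t) (germ F x U hx w) =
      germ F x U hx (tri γ s t w) := by
  refine germ_eq_iff.2 ⟨U, hx, le_inf le_rfl (le_inf le_rfl le_rfl), le_rfl, ?_⟩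
  dsimp only
  rw [res_tri, res_tri]
  congr 1 <;> exact res_res _ _ _ _

instance (x : X) : AddCommMonoid (Stalk F x) where
  add_assoc p q r := by
    obtain ⟨U, hU, s, t, w, rfl, rfl, rfl⟩ := germ_exists₃ p q r
    simp only [germ_add, add_assoc]
  zero_add p := by
    obtain ⟨U, hU, s, rfl⟩ := germ_exists p
    rw [← germ_zero x U hU, germ_add, zero_add]
  add_zero p := by
    obtain ⟨U, hU, s, rfl⟩ := germ_exists p
    rw [← germ_zero x U hU, germ_add, add_zero]
  add_comm p q := by
    obtain ⟨U, hU, s, t, rfl, rfl⟩ := germ_exists₂ p q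
    rw [germ_add, germ_add, add_comm]
  nsmul := nsmulRec

instance (x : X) : CommTernaryGammaSemiring Γ (Stalk F x) where
  tri := stalkTri x
  add_tri γ a b c d := by
    obtain ⟨U, hU, a, b, c, d, -, rfl, rfl, rfl, rfl, -⟩ := germ_exists₅ a b c d d
    simp only [germ_add, stalkTri_germ, add_tri]
  tri_add_mid γ a b c d := by
    obtain ⟨U, hU, a, b, c, d, -, rfl, rfl, rfl, rfl, -⟩ := germ_exists₅ a b c d d
    simp only [germ_add, stalkTri_germ, tri_add_mid]
  tri_add γ a b c d := by
    obtain ⟨U, hU, a, b, c, d, -, rfl, rfl, rfl, rfl, -⟩ := germ_exists₅ a b c d d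
    simp only [germ_add, stalkTri_germ, tri_add]
  tri_assoc γ δ a b c d e := by
    obtain ⟨U, hU, a, b, c, d, e, rfl, rfl, rfl, rfl, rfl⟩ := germ_exists₅ a b c d e
    simp only [stalkTri_germ, tri_assoc]
  tri_zero_mid γ a b := by
    obtain ⟨U, hU, a, b, rfl, rfl⟩ := germ_exists₂ a b
    rw [← germ_zero x U hU, stalkTri_germ, tri_zero_mid]
  tri_comm γ a b c := by
    obtain ⟨U, hU, a, b, c, rfl, rfl, rfl⟩ := germ_exists₃ a b c
    simp only [stalkTri_germ]
    rw [tri_comm]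
  one_one_tri γ a := by
    obtain ⟨U, hU, a, rfl⟩ := germ_exists a
    rw [← germ_one x U hU, stalkTri_germ, one_one_tri]
  one_tri_one γ a := by
    obtain ⟨U, hU, a, rfl⟩ := germ_exists a
    rw [← germ_one x U hU, stalkTri_germ, one_tri_one]
  tri_one_one γ a := by
    obtain ⟨U, hU, a, rfl⟩ := germ_exists a
    rw [← germ_one x U hU, stalkTri_germ, tri_one_one]

theorem tri_germ (x : X) (γ : Γ) (U : Opens X) (hx : x ∈ U) (s t w : F.obj (op U)) :
    tri γ (germ F x U hx s) (germ F x U hx t) (germ F x U hx w) =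
      germ F x U hx (tri γ s t w) := stalkTri_germ _ _ _ _ _ _ _

end Stalk

section StalkMap

variable {Γ : Type v} {X Y : PresheafedSpace.{u} (TGSemi.{v, u} Γ)} (f : X ⟶ Y)

/-- Pullback of sections along a morphism. -/
def pull (U : Opens Y) (s : Y.presheaf.obj (op U)) :
    X.presheaf.obj (op ((Opens.map f.base).obj U)) := f.c.app (op U) s

theorem pull_zero (U : Opens Y) : pull f U 0 = 0 := TGSemi.map_zero (f.c.app (op U))

theorem pull_one (U : Opens Y) : pull f U 1 = 1 := TGSemi.map_one (f.c.app (op U))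

theorem pull_add (U : Opens Y) (s t : Y.presheaf.obj (op U)) :
    pull f U (s + t) = pull f U s + pull f U t := TGSemi.map_add (f.c.app (op U)) s t

theorem pull_tri (U : Opens Y) (γ : Γ) (s t w : Y.presheaf.obj (op U)) :
    pull f U (tri γ s t w) = tri γ (pull f U s) (pull f U t) (pull f U w) :=
  TGSemi.map_tri (f.c.app (op U)) γ s t w

theorem pull_res {U V : Opens Y} (h : V ≤ U) (s : Y.presheaf.obj (op U)) :
    pull f V (res Y.presheaf h s) =
      res X.presheaf (show (Opens.map f.base).obj V ≤ (Opens.map f.base).obj U from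
        fun _ hy => h hy) (pull f U s) :=
  ConcreteCategory.congr_hom (f.c.naturality (homOfLE h).op) s

/-- The map of stalks underlying `stalkMap`. -/
def stalkMapFun (x : X) : Stalk Y.presheaf (f.base x) → Stalk X.presheaf x :=
  Quotient.lift (fun a => germ X.presheaf x ((Opens.map f.base).obj a.U) a.mem (pull f a.U a.s))
    (by
      rintro ⟨U, hU, s⟩ ⟨V, hV, t⟩ ⟨W, hx, h, k, e⟩
      refine germ_eq_iff.2 ⟨(Opens.map f.base).obj W, hx, fun _ hy => h hy, fun _ hy => k hy, ?_⟩
      rw [← pull_res f h, ← pull_res f k, e])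

theorem stalkMapFun_germ (x : X) (U : Opens Y) (hx : f.base x ∈ U)
    (s : Y.presheaf.obj (op U)) :
    stalkMapFun f x (germ Y.presheaf (f.base x) U hx s) =
      germ X.presheaf x ((Opens.map f.base).obj U) hx (pull f U s) := rfl

/-- The homomorphism of stalks induced by a morphism of spaces with a presheaf of commutative
ternary `Γ`-semirings: the germ of `s` goes to the germ of its pullback. -/
def stalkMap (x : X) : GammaHom Γ (Stalk Y.presheaf (f.base x)) (Stalk X.presheaf x) where
  toFun := stalkMapFun f x
  map_zero' := by
    rw [← germ_zero _ ⊤ (Opens.mem_top _), stalkMapFun_germ, pull_zero]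
    exact germ_zero _ _ _
  map_one' := by
    rw [← germ_one _ ⊤ (Opens.mem_top _), stalkMapFun_germ, pull_one]
    exact germ_one _ _ _
  map_add' p q := by
    obtain ⟨U, hU, s, t, rfl, rfl⟩ := germ_exists₂ p q
    simp only [germ_add, stalkMapFun_germ, pull_add]
    exact (germ_add _ _ _ _ _).symm
  map_tri' γ p q r := by
    obtain ⟨U, hU, s, t, w, rfl, rfl, rfl⟩ := germ_exists₃ p q r
    simp only [tri_germ, stalkMapFun_germ, pull_tri]
    exact (tri_germ _ _ _ _ _ _ _).symm

theorem stalkMap_germ (x : X) (U : Opens Y) (hx : f.base x ∈ U)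
    (s : Y.presheaf.obj (op U)) :
    stalkMap f x (germ Y.presheaf (f.base x) U hx s) =
      germ X.presheaf x ((Opens.map f.base).obj U) hx (pull f U s) := rfl

end StalkMap

/-! ## Locally `Γ`-semiringed spaces -/

/-- A locally `Γ`-semiringed space: a topological space with a sheaf of commutative ternary
`Γ`-semirings all of whose stalks are local. -/
structure LocallyGammaSemiringedSpace (Γ : Type v)
    extends SheafedSpace (TGSemi.{v, u} Γ) where
  isLocal : ∀ x : carrier, IsLocalGamma Γ (Stalk presheaf x)

namespace LocallyGammaSemiringedSpace

variable {Γ : Type v}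

/-- A morphism of locally `Γ`-semiringed spaces: a continuous map together with a compatible
family of pullback homomorphisms of sections, inducing local homomorphisms on stalks. -/
@[ext]
structure Hom (X Y : LocallyGammaSemiringedSpace.{v, u} Γ) where
  toHom : X.toPresheafedSpace ⟶ Y.toPresheafedSpace
  isLocal : ∀ x, (stalkMap toHom x).IsLocal

instance : Category (LocallyGammaSemiringedSpace.{v, u} Γ) where
  Hom := Hom
  id X := ⟨𝟙 X.toPresheafedSpace, fun x a h => by
    obtain ⟨U, hU, s, rfl⟩ := germ_exists a
    exact h⟩
  comp {X Y Z} f g := ⟨f.toHom ≫ g.toHom, fun x a h => by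
    obtain ⟨U, hU, s, rfl⟩ := germ_exists a
    exact g.isLocal (f.toHom.base x) _ (f.isLocal x _ h)⟩

theorem hom_ext {X Y : LocallyGammaSemiringedSpace.{v, u} Γ} {f g : X ⟶ Y}
    (h : f.toHom = g.toHom) : f = g := Hom.ext h

end LocallyGammaSemiringedSpace

/-! ## Affine `Γ`-schemes -/

section Affine

variable {Γ : Type v} [Nonempty Γ]

/-- The value in `T_P` of a germ at `P` of a section of the structure sheaf. -/
def stalkEval (T : TGSemi.{v, u} Γ) (P : specTop Γ T) :
    GammaHom Γ (Stalk (structurePresheaf Γ T) P) (Fibre Γ T P) where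
  toFun := Quotient.lift (fun a => (a.s : sectionsSub Γ T a.U).1 ⟨P, a.mem⟩) (by
    rintro ⟨U, hU, s⟩ ⟨V, hV, t⟩ ⟨W, hx, h, k, e⟩
    exact congrArg (fun w : sectionsSub Γ T W => w.1 ⟨P, hx⟩) e)
  map_zero' := rfl
  map_one' := rfl
  map_add' p q := by
    obtain ⟨U, hU, s, t, rfl, rfl⟩ := germ_exists₂ p q
    rw [germ_add]
    rfl
  map_tri' γ p q r := by
    obtain ⟨U, hU, s, t, w, rfl, rfl, rfl⟩ := germ_exists₃ p q r
    rw [tri_germ]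
    rfl

theorem stalkEval_isLocal (T : TGSemi.{v, u} Γ) (P : specTop Γ T) :
    (stalkEval T P).IsLocal := by
  intro p hp
  obtain ⟨U, hU, s, rfl⟩ := germ_exists p
  change sectionsSub Γ T U at s
  change IsInvertible Γ (s.1 ⟨P, hU⟩) at hp
  obtain ⟨V, hV, i, a, b, hs⟩ := s.2 ⟨P, hU⟩
  change ∀ Q : V, ∃ hb : b ∉ (asPrime Q.1).ideal.carrier,
    s.1 (i Q) = (asPrime Q.1).frac a b hb at hs
  obtain ⟨hb, hsP⟩ := hs ⟨P, hV⟩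
  have hsP' : s.1 ⟨P, hU⟩ = (asPrime P).frac a b hb := hsP
  rw [hsP'] at hp
  have ha : a ∉ (asPrime P).ideal.carrier := (PrimeSpec.isInvertible_mk_iff _ _ _).1 hp
  let W : Opens (specTop Γ T) :=
    V ⊓ ⟨{Q | a ∉ (asPrime Q).ideal.carrier}, PrimeSpec.isOpen_basic a⟩
  have hW : P ∈ W := ⟨hV, ha⟩
  have hWU : W ≤ U := fun Q hQ => i.le hQ.1
  let t : sectionsSub Γ T W := ⟨fun Q => (asPrime Q.1).frac b a Q.2.2, fun Q =>
    ⟨W, Q.2, 𝟙 _, b, a, fun R => ⟨R.2.2, rfl⟩⟩⟩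
  refine ⟨germ (structurePresheaf Γ T) P W hW t, fun γ => ?_⟩
  have h1 : germ (structurePresheaf Γ T) P U hU s =
      germ (structurePresheaf Γ T) P W hW (res (structurePresheaf Γ T) hWU s) :=
    germ_res (F := structurePresheaf Γ T) hW hWU s
  rw [← germ_one P W hW, h1]
  refine (tri_germ (F := structurePresheaf Γ T) P γ W hW
    (res (structurePresheaf Γ T) hWU s) t 1).trans ?_
  congr 1
  refine Subtype.ext (funext fun Q => ?_)
  change tri γ (s.1 ⟨Q.1, hWU Q.2⟩) ((asPrime Q.1).frac b a Q.2.2) 1 = 1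
  obtain ⟨hb', hsQ⟩ := hs ⟨Q.1, Q.2.1⟩
  have hsQ' : s.1 ⟨Q.1, hWU Q.2⟩ = (asPrime Q.1).frac a b hb' := hsQ
  rw [hsQ', PrimeSpec.frac, PrimeSpec.frac, Loc.one_def, Loc.tri_mk]
  apply Loc.mk_congr
  letI := asCommSemiring Γ T
  simp only [Loc.triDen, tri_eq_mul]
  ring

/-- The locally `Γ`-semiringed space `Spec T`. -/
def specSpace (T : TGSemi.{v, u} Γ) : LocallyGammaSemiringedSpace.{v, u} Γ where
  carrier := specTop Γ T
  presheaf := structurePresheaf Γ T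
  IsSheaf := structurePresheaf_isSheaf Γ T
  isLocal P := isLocalGamma_of_isLocal (stalkEval_isLocal T P)
    (PrimeSpec.not_isInvertible_zero _) (PrimeSpec.isInvertible_add _)

section SpecMap

variable {T T' : TGSemi.{v, u} Γ} (f : T ⟶ T')

/-- The continuous map `P ↦ f⁻¹(P)`. -/
def specBase : specTop Γ T' ⟶ specTop Γ T :=
  TopCat.ofHom (X := PrimeSpec Γ T') (Y := PrimeSpec Γ T)
    ⟨PrimeSpec.comap f.hom, PrimeSpec.continuous_comap f.hom⟩

/-- The pullback of sections along `Spec f`: a section `s` over `U` is sent to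
`P ↦ f_P (s (f⁻¹(P)))`, where `f_P : T_{f⁻¹(P)} → T'_P` sends `a / s` to `f a / f s`. -/
def specPull (U : Opens (specTop Γ T)) :
    GammaHom Γ (sectionsSub Γ T U) (sectionsSub Γ T' ((Opens.map (specBase f)).obj U)) where
  toFun s := ⟨fun P => PrimeSpec.localMap f.hom (asPrime P.1) (s.1 ⟨specBase f P.1, P.2⟩),
    fun P => by
      obtain ⟨V, hV, i, a, b, hs⟩ := s.2 ⟨specBase f P.1, P.2⟩
      refine ⟨(Opens.map (specBase f)).obj V, hV, (Opens.map (specBase f)).map i,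
        f a, f b, fun Q => ?_⟩
      obtain ⟨hb, hs⟩ := hs ⟨specBase f Q.1, Q.2⟩
      exact ⟨hb, congrArg (PrimeSpec.localMap f.hom (asPrime Q.1)) hs⟩⟩
  map_zero' := Subtype.ext (funext fun _ => GammaHom.map_zero _)
  map_one' := Subtype.ext (funext fun _ => GammaHom.map_one _)
  map_add' s t := Subtype.ext (funext fun _ => GammaHom.map_add _ _ _)
  map_tri' γ s t w := Subtype.ext (funext fun _ => GammaHom.map_tri _ γ _ _ _)

/-- The pullbacks of sections along `Spec f`, as a morphism of presheaves. -/
def specSheafMap :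
    structurePresheaf Γ T ⟶ (TopCat.Presheaf.pushforward _ (specBase f)).obj
      (structurePresheaf Γ T') where
  app U := TGSemi.ofHom (A := TGSemi.of Γ (sectionsSub Γ T U.unop))
    (B := TGSemi.of Γ (sectionsSub Γ T' ((Opens.map (specBase f)).obj U.unop)))
    (specPull f U.unop)
  naturality _ _ _ := rfl

/-- The morphism of spaces with a presheaf underlying `Spec f`. -/
def specHom : (specSpace T').toPresheafedSpace ⟶ (specSpace T).toPresheafedSpace where
  base := specBase f
  c := specSheafMap f

theorem localMap_isLocal (P : PrimeSpec Γ T') : (PrimeSpec.localMap f.hom P).IsLocal := by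
  intro x hx
  induction x using Loc.ind with | _ a s => ?_
  rw [PrimeSpec.isInvertible_mk_iff]
  exact (PrimeSpec.isInvertible_mk_iff P _ _).1 hx

/-- The morphism of locally `Γ`-semiringed spaces `Spec T' ⟶ Spec T` induced by `f : T ⟶ T'`. -/
def specMap : specSpace T' ⟶ specSpace T :=
  { toHom := specHom f
    isLocal := fun (P : specTop Γ T') a h => by
      apply stalkEval_isLocal T (specBase f P)
      apply localMap_isLocal f (asPrime P)
      have h' := h.map (stalkEval T' P)
      obtain ⟨U, hU, s, rfl⟩ := germ_exists a
      exact h' }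

end SpecMap

variable (Γ) in
/-- The category of affine `Γ`-schemes: the locally `Γ`-semiringed spaces isomorphic to the
spectrum of some commutative ternary `Γ`-semiring, with all morphisms of locally `Γ`-semiringed
spaces between them. -/
abbrev AffGamma : Type (max v (u + 1)) :=
  ObjectProperty.FullSubcategory
    (fun X : LocallyGammaSemiringedSpace.{v, u} Γ => ∃ T : TGSemi.{v, u} Γ,
      Nonempty (X ≅ specSpace T))

/-- `Spec T` as an affine `Γ`-scheme. -/
def affineSpec (T : TGSemi.{v, u} Γ) : AffGamma.{v, u} Γ := ⟨specSpace T, T, ⟨Iso.refl _⟩⟩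

/-- `Spec f` as a morphism of affine `Γ`-schemes. -/
def affineSpecMap {T T' : TGSemi.{v, u} Γ} (f : T ⟶ T') : affineSpec T' ⟶ affineSpec T :=
  ObjectProperty.homMk (specMap f)

variable (Γ) in
/-- The (contravariant) global sections functor `X ↦ 𝒪_X(X)`. -/
def globalSections : (AffGamma.{v, u} Γ)ᵒᵖ ⥤ TGSemi.{v, u} Γ where
  obj X := X.unop.obj.presheaf.obj (op ⊤)
  map f := f.unop.hom.toHom.c.app (op ⊤)
  map_id _ := rfl
  map_comp _ _ := rfl

/-- The canonical homomorphism `T ⟶ 𝒪(Spec T)`, sending `a` to the section `P ↦ a / 1`. -/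
def toGlobalSections (T : TGSemi.{v, u} Γ) :
    T ⟶ (globalSections Γ).obj (op (affineSpec T)) :=
  TGSemi.ofHom (A := T) (B := TGSemi.of Γ (sectionsSub Γ T ⊤))
    { toFun := fun a => ⟨fun P => Loc.toLoc (asPrime P.1).compl a, fun _ =>
        ⟨⊤, trivial, 𝟙 _, a, 1, fun Q => ⟨(asPrime Q.1).one_notMem, rfl⟩⟩⟩
      map_zero' := Subtype.ext (funext fun _ => GammaHom.map_zero _)
      map_one' := Subtype.ext (funext fun _ => GammaHom.map_one _)
      map_add' := fun _ _ => Subtype.ext (funext fun _ => GammaHom.map_add _ _ _)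
      map_tri' := fun γ _ _ _ => Subtype.ext (funext fun _ => GammaHom.map_tri _ γ _ _ _) }

end Affine

end

end GammaGeometry

open GammaGeometry

/-! The identity element collapses the ternary structure: by `tri_eq_mul`, every product `{a, b,
c}_γ` equals `a * b * c` for one commutative semiring product, whatever `γ` is. Prime `Γ`-ideals and
localizations therefore become those of an ordinary commutative semiring, and the theorem becomes
the duality between rings and affine schemes, to be proved without subtraction. Where ring theory
uses the annihilator of `a - b`, the ideal of all `w` with `w * a = w * b` takes its place.

Two facts carry the proof. The first is that `λ_T` is an isomorphism. It is injective because two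
elements equal in every localization have an equalizer ideal contained in no prime. It is surjective
because a section is given by finitely many fractions that agree on overlaps up to powers of the
denominators; a partition of unity glues them (`exists_glue_fractions`).

The second is that a morphism `ψ` between spectra is determined by its effect on global sections
(`eq_specMap`). On points, the prime at a point is read off from the stalk: `a` lies outside it
exactly when the germ of `λ a` is invertible, and local homomorphisms preserve and reflect this. On
sections, a fraction `a / b` is the only solution `x` of `x * b = a`, and pullback preserves this
equation.

The rest is formal. Uniqueness gives functoriality and, together with the isomorphism `λ_T`, the
bijection on homomorphisms. Transport along an isomorphism with a spectrum extends that bijection to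
every affine source, and this is the adjunction. -/

namespace GammaGeometry

/-! ## Prime ideals and gluing of fractions in commutative semirings -/

section CommSemiring

variable {R : Type u} [CommSemiring R]

/-- The radical of an ideal is the intersection of the primes above it, also in a semiring. Applied
to equalizer ideals, this turns equality at all primes avoiding `f` into one equation multiplied by
a power of `f`. -/
theorem exists_pow_mem_of_forall_isPrime (I : Ideal R) (f : R)
    (h : ∀ p : Ideal R, p.IsPrime → I ≤ p → f ∈ p) : ∃ n : ℕ, f ^ n ∈ I := by
  have hf : f ∈ I.radical := by
    rw [Ideal.radical_eq_sInf, Ideal.mem_sInf]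
    exact fun J hJ => h J hJ.2 hJ.1
  exact hf

/-- A proper ideal lies in a maximal ideal, which is prime. -/
theorem eq_top_of_forall_isPrime (I : Ideal R)
    (h : ∀ p : Ideal R, p.IsPrime → ¬ I ≤ p) : I = ⊤ := by
  by_contra hI
  obtain ⟨M, hM, hIM⟩ := I.exists_le_maximal hI
  exact h M hM.isPrime hIM

/-- The elements by which `a` and `b` have the same multiples. -/
def equalizerIdeal (a b : R) : Ideal R where
  carrier := {w | w * a = w * b}
  zero_mem' := by simp
  add_mem' {x y} hx hy := by
    change (x + y) * a = (x + y) * b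
    rw [add_mul, add_mul, hx, hy]
  smul_mem' c x hx := by
    change c * x * a = c * x * b
    rw [mul_assoc, mul_assoc, hx]

theorem mem_equalizerIdeal {a b w : R} : w ∈ equalizerIdeal a b ↔ w * a = w * b := Iff.rfl

/-- Fractions `p.1 / p.2` whose denominators generate the unit ideal and which agree on overlaps
come from one element of the semiring. -/
theorem exists_glue_fractions (A : Set (R × R)) (hA : Ideal.span (Prod.snd '' A) = ⊤)
    (h : ∀ p ∈ A, ∀ q ∈ A, ∃ n : ℕ,
      (p.2 * q.2) ^ n * (p.1 * q.2) = (p.2 * q.2) ^ n * (q.1 * p.2)) :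
    ∃ r : R, ∀ P : Ideal R, P.IsPrime →
      ∃ p ∈ A, ∃ n : ℕ, p.2 ∉ P ∧ p.2 ^ n * (p.2 * r) = p.2 ^ n * p.1 := by
  classical
  -- Compactness: finitely many denominators already generate the unit ideal. The finite set `t`
  -- picks fractions with these denominators.
  obtain ⟨s, hs, hs1⟩ := (Ideal.span_eq_top_iff_finite _).1 hA
  obtain ⟨t, ht, rfl⟩ := Finset.subset_set_image_iff.1 hs
  choose! n hn using h
  let N : ℕ := (t ×ˢ t).sup fun x => n x.1 x.2
  -- Rewrite each fraction as `(p.2 ^ N * p.1) / p.2 ^ (N + 1)`. Since `N` bounds the exponents of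
  -- all pairs, cross-multiplication then holds with no auxiliary factor.
  have hN : ∀ p ∈ t, ∀ q ∈ t,
      p.2 ^ N * p.1 * q.2 ^ (N + 1) = q.2 ^ N * q.1 * p.2 ^ (N + 1) := by
    intro p hp q hq
    have hle : n p q ≤ N :=
      Finset.le_sup (f := fun x : (R × R) × (R × R) => n x.1 x.2)
        (Finset.mk_mem_product hp hq)
    obtain ⟨k, hk⟩ := Nat.exists_eq_add_of_le hle
    have e := hn p (ht hp) q (ht hq)
    calc p.2 ^ N * p.1 * q.2 ^ (N + 1)
        = (p.2 * q.2) ^ k * ((p.2 * q.2) ^ n p q * (p.1 * q.2)) := by rw [hk]; ring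
      _ = q.2 ^ N * q.1 * p.2 ^ (N + 1) := by rw [e, hk]; ring
  -- Powers of generators of the unit ideal still generate it; the coefficients `c` form a partition
  -- of unity for the new denominators.
  have h1 : (1 : R) ∈ Ideal.span ((fun p : R × R => p.2 ^ (N + 1)) '' (t : Set (R × R))) := by
    have := Ideal.span_pow_eq_top _ hs1 (N + 1)
    rw [Finset.coe_image, Set.image_image] at this
    rw [this]
    trivial
  obtain ⟨c, hc⟩ := (Submodule.mem_span_image_finset_iff_exists_fun R).1 h1
  refine ⟨∑ p : t, c p * (p.1.2 ^ N * p.1.1), fun P hP => ?_⟩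
  -- A prime containing every chosen denominator would be the whole semiring.
  obtain ⟨q, hq, hqP⟩ : ∃ q ∈ t, q.2 ∉ P := by
    by_contra! hall
    refine hP.ne_top (top_unique (hs1 ▸ Ideal.span_le.2 fun x hx => ?_))
    obtain ⟨q, hq, rfl⟩ := Finset.mem_image.1 (Finset.mem_coe.1 hx)
    exact hall q hq
  refine ⟨q, ht hq, N, hqP, ?_⟩
  calc q.2 ^ N * (q.2 * ∑ p : t, c p * (p.1.2 ^ N * p.1.1))
      = ∑ p : t, c p * (p.1.2 ^ N * p.1.1 * q.2 ^ (N + 1)) := by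
        rw [Finset.mul_sum, Finset.mul_sum]
        exact Finset.sum_congr rfl fun p _ => by ring
    _ = ∑ p : t, (c p • p.1.2 ^ (N + 1)) * (q.2 ^ N * q.1) :=
        Finset.sum_congr rfl fun p _ => by rw [hN p.1 p.2 q hq, smul_eq_mul]; ring
    _ = q.2 ^ N * q.1 := by rw [← Finset.sum_mul, hc, one_mul]

end CommSemiring

/-! ## Global sections of the structure sheaf -/

section GlobalSections

variable {Γ : Type v} [Nonempty Γ]

/-- A prime ideal of the underlying semiring, as a prime `Γ`-ideal. -/
def primeSpecOfIdeal (T : TGSemi.{v, u} Γ) :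
    letI := asCommSemiring Γ T
    ∀ p : Ideal T, p.IsPrime → PrimeSpec Γ T :=
  letI := asCommSemiring Γ T
  fun p hp =>
  { ideal :=
      { carrier := p
        zero_mem := p.zero_mem
        add_mem := fun _ _ ha hb => p.add_mem ha hb
        tri_mem_left := fun γ a b c ha => by
          rw [tri_eq_mul]; exact p.mul_mem_right _ (p.mul_mem_right _ ha)
        tri_mem_mid := fun γ a b c ha => by
          rw [tri_eq_mul]; exact p.mul_mem_right _ (p.mul_mem_left _ ha)
        tri_mem_right := fun γ a b c ha => by
          rw [tri_eq_mul]; exact p.mul_mem_left _ ha }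
    proper := fun h => hp.ne_top (SetLike.coe_injective h)
    prime := fun γ a b c h => by
      rw [tri_eq_mul] at h
      rcases hp.mem_or_mem h with h | h
      · exact (hp.mem_or_mem h).imp_right Or.inl
      · exact Or.inr (Or.inr h) }

/-- A prime `Γ`-ideal, as an ideal of the underlying semiring. -/
def PrimeSpec.toIdeal {T : TGSemi.{v, u} Γ} (P : PrimeSpec Γ T) :
    letI := asCommSemiring Γ T
    Ideal T :=
  letI := asCommSemiring Γ T
  { carrier := P.ideal.carrier
    zero_mem' := P.ideal.zero_mem
    add_mem' := fun ha hb => P.ideal.add_mem _ _ ha hb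
    smul_mem' := fun _ _ hx => P.ideal.tri_mem_mid _ _ _ _ hx }

/-- The binary product is a ternary product with third factor `1`, and `1 ∉ P` rules out the third
alternative of ternary primality. -/
theorem PrimeSpec.isPrime_toIdeal {T : TGSemi.{v, u} Γ} (P : PrimeSpec Γ T) :
    letI := asCommSemiring Γ T
    P.toIdeal.IsPrime := by
  letI := asCommSemiring Γ T
  refine Ideal.isPrime_iff.2 ⟨fun h => P.one_notMem ((Ideal.eq_top_iff_one _).1 h), ?_⟩
  intro x y h
  rcases P.prime _ _ _ _ h with h | h | h
  exacts [Or.inl h, Or.inr h, (P.one_notMem h).elim]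

/-- Equality of `a / 1` and `b / 1` at a prime yields some `w` outside it with `w * a = w * b`. The
equalizer ideal thus lies in no prime, so it contains `1`. -/
theorem toGlobalSections_injective (T : TGSemi.{v, u} Γ) :
    Function.Injective (toGlobalSections T) := by
  intro a b hab
  letI := asCommSemiring Γ T
  have htop : equalizerIdeal a b = ⊤ := by
    refine eq_top_of_forall_isPrime _ fun p hp hle => ?_
    let P : PrimeSpec Γ T := primeSpecOfIdeal T p hp
    have e : P.frac a 1 P.one_notMem = P.frac b 1 P.one_notMem :=
      congrArg (fun s : sectionsSub Γ T ⊤ => s.1 ⟨P, trivial⟩) hab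
    obtain ⟨w, hw, e⟩ := Loc.mk_eq_mk.1 e
    rw [mul_one, mul_one] at e
    exact hw (hle e)
  have h1 : (1 : T) ∈ equalizerIdeal a b := by rw [htop]; trivial
  rwa [mem_equalizerIdeal, one_mul, one_mul] at h1

/-- Each section is a fraction on a basic open neighbourhood of each point. -/
theorem exists_fraction_on_basic (T : TGSemi.{v, u} Γ) (s : sectionsSub Γ T ⊤)
    (P : PrimeSpec Γ T) :
    ∃ a f : T, f ∉ P.ideal.carrier ∧ ∀ (Q : PrimeSpec Γ T) (hQ : f ∉ Q.ideal.carrier),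
      s.1 ⟨Q, trivial⟩ = Q.frac a f hQ := by
  obtain ⟨V, hV, i, a, b, hs⟩ := s.2 ⟨P, trivial⟩
  obtain ⟨I, hI⟩ := V.2
  -- `V` is the complement of the zero locus of `I`, so `P ∈ V` means `I ⊄ P`. Any prime avoiding
  -- such a `c` is again in `V`; expanding `a / b` by `c` therefore makes the denominator itself cut
  -- out a neighbourhood inside `V`.
  obtain ⟨c, hcI, hcP⟩ : ∃ c ∈ I.carrier, c ∉ P.ideal.carrier := by
    by_contra! h
    have : P ∈ PrimeSpec.zeroLocus I := h
    rw [← hI] at this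
    exact this hV
  letI := asCommSemiring Γ T
  obtain ⟨hb, -⟩ := hs ⟨P, hV⟩
  refine ⟨a * c, b * c, P.compl.mul_mem hb hcP, fun Q hQ => ?_⟩
  have hcQ : c ∉ Q.ideal.carrier := fun h => hQ (Q.toIdeal.mul_mem_left b h)
  have hQV : (Q : specTop Γ T) ∈ V := by
    by_contra hn
    have : Q ∈ (V : Set (specTop Γ T))ᶜ := hn
    erw [hI] at this
    exact hcQ (this hcI)
  obtain ⟨hb, e⟩ := hs ⟨Q, hQV⟩
  refine Eq.trans e (Loc.mk_congr ?_)
  ring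

theorem toGlobalSections_surjective (T : TGSemi.{v, u} Γ) :
    Function.Surjective (toGlobalSections T) := by
  intro s
  change sectionsSub Γ T ⊤ at s
  letI := asCommSemiring Γ T
  -- All fractions that represent `s` wherever their denominator does not vanish. Every prime misses
  -- one of these denominators, so together they generate the unit ideal.
  let A : Set (T × T) := {p | ∀ (Q : PrimeSpec Γ T) (hQ : p.2 ∉ Q.ideal.carrier),
      s.1 ⟨Q, trivial⟩ = Q.frac p.1 p.2 hQ}
  obtain ⟨r, hr⟩ := exists_glue_fractions A
    (by
      refine eq_top_of_forall_isPrime _ fun p hp hle => ?_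
      obtain ⟨a, f, hf, h⟩ := exists_fraction_on_basic T s (primeSpecOfIdeal T p hp)
      exact hf (hle (Ideal.subset_span ⟨(a, f), h, rfl⟩)))
    (by
      rintro ⟨a, f⟩ hp ⟨b, g⟩ hq
      -- At a prime avoiding `f * g`, both fractions equal the value of `s`, so some `w` outside the
      -- prime equalizes `a * g` and `b * f`. Hence a power of `f * g` does.
      refine exists_pow_mem_of_forall_isPrime (equalizerIdeal (a * g) (b * f)) (f * g)
        fun p hp' hle => ?_
      by_contra hn
      let P : PrimeSpec Γ T := primeSpecOfIdeal T p hp'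
      have hf : f ∉ P.ideal.carrier := fun h => hn (p.mul_mem_right _ h)
      have hg : g ∉ P.ideal.carrier := fun h => hn (p.mul_mem_left _ h)
      obtain ⟨w, hw, e⟩ := Loc.mk_eq_mk.1 ((hp P hf).symm.trans (hq P hg))
      rw [mul_assoc, mul_assoc] at e
      exact hw (hle e))
  refine ⟨r, Subtype.ext (funext fun ⟨P, _⟩ => ?_)⟩
  obtain ⟨⟨a, f⟩, hp, n, hf, e⟩ := hr (PrimeSpec.toIdeal P) (PrimeSpec.isPrime_toIdeal P)
  refine Eq.trans ?_ (hp P hf).symm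
  -- The power of `f` left over from gluing is the factor witnessing `r / 1 = a / f`.
  refine Loc.mk_eq_mk.2 ⟨f ^ n, ?_, ?_⟩
  · exact fun h => hf ((PrimeSpec.isPrime_toIdeal P).mem_of_pow_mem _ h)
  · dsimp only at e ⊢
    rw [mul_one, ← e]
    ring

end GlobalSections

/-! ## Morphisms into affine spectra -/

section Morphisms

variable {Γ : Type v}

open TernaryGammaSemiring

/-- Locality of the stalk map is one direction; every homomorphism preserves invertibility, which is
the other. -/
theorem isInvertible_germ_pull_iff {X Y : LocallyGammaSemiringedSpace.{v, u} Γ} (f : X ⟶ Y)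
    (x : X.carrier) (a : Y.presheaf.obj (op ⊤)) :
    IsInvertible Γ (germ X.presheaf x ⊤ trivial (pull f.toHom ⊤ a)) ↔
      IsInvertible Γ (germ Y.presheaf (f.toHom.base x) ⊤ trivial a) :=
  ⟨f.isLocal x (germ Y.presheaf (f.toHom.base x) ⊤ trivial a),
    fun h => h.map (stalkMap f.toHom x)⟩

/-- Pullback is a homomorphism compatible with restriction, so the equation expressing that `s` is
the fraction `a / b` on `V` survives it. Only global sections enter as numerator and denominator, so
the effect on `s` is controlled by the effect on global sections. -/
theorem pull_tri_eq_of_tri_eq {X Y : PresheafedSpace.{u} (TGSemi.{v, u} Γ)} (f : X ⟶ Y)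
    {U V : Opens Y} (h : V ≤ U) (γ : Γ) {s : Y.presheaf.obj (op U)}
    {a b : Y.presheaf.obj (op ⊤)}
    (e : tri γ (res Y.presheaf h s) (res Y.presheaf le_top b) 1 = res Y.presheaf le_top a) :
    tri γ (res X.presheaf (show (Opens.map f.base).obj V ≤ (Opens.map f.base).obj U from
        fun _ hy => h hy) (pull f U s))
      (res X.presheaf (V := (Opens.map f.base).obj V) le_top (pull f ⊤ b)) 1 =
      res X.presheaf le_top (pull f ⊤ a) := by
  have e' := congrArg (pull f V) e
  rw [pull_tri, pull_res, pull_res, pull_res, pull_one] at e'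
  exact e'

variable [Nonempty Γ]

/-- The equation `x · b / 1 = a / 1` characterizes the fraction `a / b`. -/
theorem PrimeSpec.tri_frac_eq_iff {T : TGSemi.{v, u} Γ} (P : PrimeSpec Γ T) (γ : Γ)
    (x : P.AtPrime) (a b : T) (hb : b ∉ P.ideal.carrier) :
    tri γ x (P.frac b 1 P.one_notMem) 1 = P.frac a 1 P.one_notMem ↔ x = P.frac a b hb := by
  letI := asCommSemiring Γ T
  induction x using Loc.ind with | _ c s => ?_
  rw [Loc.one_def, PrimeSpec.frac, PrimeSpec.frac, PrimeSpec.frac, Loc.tri_mk, Loc.mk_eq_mk,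
    Loc.mk_eq_mk]
  -- With `x = c / s`, both sides say that some `w ∉ P` satisfies `w * c * b = w * a * s`.
  simp only [Loc.triDen, tri_eq_mul, mul_one, mul_assoc]

/-- Evaluation of germs in `T_P` preserves and reflects invertibility, and `a / 1` is invertible in
`T_P` exactly when `a ∉ P`. -/
theorem isInvertible_germ_iff (T : TGSemi.{v, u} Γ) (P : specTop Γ T) (a : T) :
    IsInvertible Γ (germ (structurePresheaf Γ T) P ⊤ trivial (toGlobalSections T a)) ↔
      a ∉ (asPrime P).ideal.carrier := by
  rw [← PrimeSpec.isInvertible_mk_iff (asPrime P) a ⟨1, (asPrime P).one_notMem⟩]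
  exact ⟨fun h => h.map (stalkEval T P), fun h => stalkEval_isLocal T P _ h⟩

variable {T T' : TGSemi.{v, u} Γ}

/-- Invertibility of germs detects membership at both ends: `a ∉ ψ(P)` iff the germ of `λ a` at
`ψ(P)` is invertible, iff its pullback, the germ of `λ (φ a)` at `P`, is invertible, iff `φ a ∉ P`.
-/
theorem base_eq_comap (φ : T' ⟶ T) (ψ : specSpace T ⟶ specSpace T')
    (h : ∀ a, pull ψ.toHom ⊤ (toGlobalSections T' a) = toGlobalSections T (φ a))
    (P : specTop Γ T) : ψ.toHom.base P = specBase φ P := by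
  have key : ∀ a : T', a ∉ (asPrime (T := T') (ψ.toHom.base P)).ideal.carrier ↔
      φ a ∉ (asPrime P).ideal.carrier := by
    intro a
    refine (isInvertible_germ_iff T' _ a).symm.trans ((Iff.symm ?_).trans
      (isInvertible_germ_iff T P (φ a)))
    rw [← h a]
    exact isInvertible_germ_pull_iff ψ P _
  refine PrimeSpec.ext (GammaIdeal.ext (Set.ext fun a => ?_))
  exact not_iff_not.1 (key a)

/-- A morphism of presheaves over `P ↦ φ⁻¹(P)` that agrees with `φ` on global sections is the
pullback of sections along `Spec φ`. -/
theorem eq_specSheafMap (φ : T' ⟶ T)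
    (c : structurePresheaf Γ T' ⟶ (TopCat.Presheaf.pushforward _ (specBase φ)).obj
      (structurePresheaf Γ T))
    (h : ∀ a, c.app (op ⊤) (toGlobalSections T' a) = toGlobalSections T (φ a)) :
    c = specSheafMap φ := by
  let F : (specSpace T).toPresheafedSpace ⟶ (specSpace T').toPresheafedSpace := ⟨specBase φ, c⟩
  refine NatTrans.ext (funext fun U => TGSemi.ext_hom fun s => ?_)
  induction U using Opposite.rec with | _ U => ?_
  change sectionsSub Γ T' U at s
  refine Subtype.ext (funext fun ⟨P, hP⟩ => ?_)
  obtain ⟨V, hV, i, a, b, hs⟩ := s.2 ⟨specBase φ P, hP⟩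
  obtain ⟨hb, hsP⟩ := hs ⟨specBase φ P, hV⟩
  -- On `V` the section `s` is the fraction `a / b`, encoded here as an equation between sections so
  -- that it can be pulled back along `c`.
  have e1 : tri (Classical.arbitrary Γ) (res (structurePresheaf Γ T') i.le s)
      (res (structurePresheaf Γ T') le_top (toGlobalSections T' b)) 1 =
      res (structurePresheaf Γ T') le_top (toGlobalSections T' a) := by
    refine Subtype.ext (funext fun Q => ?_)
    obtain ⟨hbQ, hsQ⟩ := hs Q
    exact ((asPrime Q.1).tri_frac_eq_iff _ _ a b hbQ).2 hsQ
  have e2 : tri (Classical.arbitrary Γ) (res (structurePresheaf Γ T) (show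
        (Opens.map (specBase φ)).obj V ≤ (Opens.map (specBase φ)).obj U from fun _ hy => i.le hy)
        (c.app (op U) s))
      (res (structurePresheaf Γ T) le_top (toGlobalSections T (φ b))) 1 =
      res (structurePresheaf Γ T) le_top (toGlobalSections T (φ a)) := by
    rw [← h a, ← h b]
    exact pull_tri_eq_of_tri_eq F i.le _ e1
  refine Eq.trans ?_ (congrArg (PrimeSpec.localMap φ.hom (asPrime P)) hsP).symm
  -- The pulled-back equation at `P` has the single solution `φ a / φ b`, the value prescribed by
  -- `Spec φ`. Here `hb` is read as `φ b ∉ P`, the meaning of `b ∉ φ⁻¹(P)`.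
  refine ((asPrime P).tri_frac_eq_iff (Classical.arbitrary Γ) _ (φ a) (φ b) hb).1 ?_
  exact congrArg (fun t : sectionsSub Γ T ((Opens.map (specBase φ)).obj V) => t.1 ⟨P, hV⟩) e2

theorem eq_specMap (φ : T' ⟶ T) (ψ : specSpace T ⟶ specSpace T')
    (h : ∀ a, pull ψ.toHom ⊤ (toGlobalSections T' a) = toGlobalSections T (φ a)) :
    ψ = specMap φ := by
  have hbase : ψ.toHom.base = specBase φ :=
    ConcreteCategory.hom_ext _ _ (base_eq_comap φ ψ h)
  apply LocallyGammaSemiringedSpace.hom_ext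
  change ψ.toHom = specHom φ
  obtain ⟨⟨base, c⟩, hloc⟩ := ψ
  dsimp only at hbase
  -- The type of `c` depends on the point map; after the substitution it is a map over `specBase φ`
  -- and can be compared with `specSheafMap φ`.
  subst hbase
  have := eq_specSheafMap φ c h
  subst this
  rfl

/-! ### Functoriality of `Spec` and its full faithfulness -/

theorem toGlobalSections_naturality (φ : T' ⟶ T) :
    toGlobalSections T' ≫ (globalSections Γ).map (affineSpecMap φ).op =
      φ ≫ toGlobalSections T := by
  refine TGSemi.ext_hom fun a => Subtype.ext (funext fun P => ?_)
  refine Loc.mk_congr ?_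
  -- Pulling back `a / 1` gives `φ a / φ 1`, to be compared with `φ a / 1`.
  change tri _ (φ a) 1 1 = tri _ (φ a) (φ 1) 1
  rw [TGSemi.map_one]

/-- Here and for composites, both sides act alike on the image of `λ`, and `eq_specMap` gives
equality without any comparison of point maps or fractions. -/
theorem affineSpecMap_id (T : TGSemi.{v, u} Γ) : affineSpecMap (𝟙 T) = 𝟙 (affineSpec T) := by
  have e : specMap (𝟙 T) = 𝟙 (specSpace T) :=
    (eq_specMap (𝟙 T) (𝟙 (specSpace T)) fun _ => rfl).symm
  exact congrArg ObjectProperty.homMk e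

theorem affineSpecMap_comp {T T' T'' : TGSemi.{v, u} Γ} (f : T ⟶ T') (g : T' ⟶ T'') :
    affineSpecMap (f ≫ g) = affineSpecMap g ≫ affineSpecMap f := by
  have hf := ConcreteCategory.congr_hom (toGlobalSections_naturality f)
  have hg := ConcreteCategory.congr_hom (toGlobalSections_naturality g)
  have e : specMap (f ≫ g) = specMap g ≫ specMap f := by
    refine (eq_specMap (f ≫ g) (specMap g ≫ specMap f) fun a => ?_).symm
    exact (congrArg (pull (specMap g).toHom ⊤) (hf a)).trans (hg (f a))
  exact congrArg ObjectProperty.homMk e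

/-- The canonical map `T ⟶ 𝒪(Spec T)` is an isomorphism. -/
noncomputable def globalSectionsIso (T : TGSemi.{v, u} Γ) :
    T ≅ (globalSections Γ).obj (op (affineSpec T)) :=
  let e := Equiv.ofBijective (toGlobalSections T)
    ⟨toGlobalSections_injective T, toGlobalSections_surjective T⟩
  have he : ∀ x, toGlobalSections T (e.symm x) = x := e.apply_symm_apply
  { hom := toGlobalSections T
    inv := TGSemi.ofHom
      { toFun := e.symm
        map_zero' := toGlobalSections_injective T (by rw [he, TGSemi.map_zero])
        map_one' := toGlobalSections_injective T (by rw [he, TGSemi.map_one])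
        map_add' := fun a b => toGlobalSections_injective T (by
          rw [he, TGSemi.map_add, he, he])
        map_tri' := fun γ a b c => toGlobalSections_injective T (by
          rw [he, TGSemi.map_tri, he, he, he]) }
    hom_inv_id := TGSemi.ext_hom fun a => e.symm_apply_apply a
    inv_hom_id := TGSemi.ext_hom he }

/-- Morphisms of affine spectra correspond to homomorphisms. -/
noncomputable def affineSpecHomEquiv (T T' : TGSemi.{v, u} Γ) :
    (affineSpec T ⟶ affineSpec T') ≃ (T' ⟶ T) where
  toFun ψ := toGlobalSections T' ≫ (globalSections Γ).map ψ.op ≫ (globalSectionsIso T).inv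
  invFun φ := affineSpecMap φ
  left_inv ψ := by
    apply ObjectProperty.hom_ext
    refine (eq_specMap _ ψ.hom fun a => ?_).symm
    -- This is the hypothesis of `eq_specMap` for `ψ`: the inverse of `λ_T` in the definition of `φ`
    -- cancels.
    have e : (toGlobalSections T' ≫ (globalSections Γ).map ψ.op ≫ (globalSectionsIso T).inv) ≫
        toGlobalSections T = toGlobalSections T' ≫ (globalSections Γ).map ψ.op := by
      rw [Category.assoc, Category.assoc]
      exact congrArg _ (congrArg _ (globalSectionsIso T).inv_hom_id)
    exact (ConcreteCategory.congr_hom e a).symm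
  right_inv φ := by
    change toGlobalSections T' ≫ (globalSections Γ).map (affineSpecMap φ).op ≫
      (globalSectionsIso T).inv = φ
    rw [← Category.assoc, toGlobalSections_naturality, Category.assoc]
    exact (congrArg _ (globalSectionsIso T).hom_inv_id).trans (Category.comp_id _)

theorem affineSpecHomEquiv_comp (T T' : TGSemi.{v, u} Γ) (ψ : affineSpec T ⟶ affineSpec T') :
    affineSpecHomEquiv T T' ψ ≫ toGlobalSections T =
      toGlobalSections T' ≫ (globalSections Γ).map ψ.op := by
  change (toGlobalSections T' ≫ (globalSections Γ).map ψ.op ≫ (globalSectionsIso T).inv) ≫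
    (globalSectionsIso T).hom = _
  rw [Category.assoc, Category.assoc, Iso.inv_hom_id, Category.comp_id]

/-- `Spec T` represents homomorphisms from `T` to global sections, on affine schemes. -/
theorem bijective_comp_globalSections_map (T : TGSemi.{v, u} Γ) (X : AffGamma.{v, u} Γ) :
    Function.Bijective (fun ψ : X ⟶ affineSpec T =>
      toGlobalSections T ≫ (globalSections Γ).map ψ.op) := by
  obtain ⟨T', ⟨i⟩⟩ := X.2
  -- The isomorphism with a spectrum is one of locally `Γ`-semiringed spaces; fullness of the
  -- subcategory makes it one of affine `Γ`-schemes.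
  let j : X ≅ affineSpec T' := (ObjectProperty.fullyFaithfulι _).preimageIso i
  let k := (globalSections Γ).mapIso j.op
  let E : (X ⟶ affineSpec T) ≃ (T ⟶ (globalSections Γ).obj (op X)) :=
    (j.homCongr (Iso.refl _)).trans ((affineSpecHomEquiv T' T).trans
      ((Iso.refl T).homCongr ((globalSectionsIso T').trans k)))
  convert E.bijective using 1
  funext ψ
  -- It remains to see that the transported bijection is the stated map: the pullbacks along `j.inv`
  -- and `j.hom` cancel.
  change _ = 𝟙 T ≫ affineSpecHomEquiv T' T (j.inv ≫ ψ ≫ 𝟙 _) ≫ toGlobalSections T' ≫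
    (globalSections Γ).map j.hom.op
  rw [Category.id_comp, Category.comp_id, ← Category.assoc (affineSpecHomEquiv T' T _),
    affineSpecHomEquiv_comp, Category.assoc, ← Functor.map_comp, ← op_comp, Iso.hom_inv_id_assoc]

end Morphisms

end GammaGeometry

/-! ### Assembly of the adjunction -/

theorem mainTheorem3 (Γ : Type v) [Nonempty Γ] :
    ∃ (map_id : ∀ T : TGSemi.{v, u} Γ, affineSpecMap (𝟙 T) = 𝟙 (affineSpec T))
      (map_comp : ∀ (T T' T'' : TGSemi.{v, u} Γ) (f : T ⟶ T') (g : T' ⟶ T''),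
        affineSpecMap (f ≫ g) = affineSpecMap g ≫ affineSpecMap f),
      let Spec : (TGSemi.{v, u} Γ)ᵒᵖ ⥤ AffGamma.{v, u} Γ :=
        { obj := fun T => affineSpec T.unop
          map := fun f => affineSpecMap f.unop
          map_id := fun T => map_id T.unop
          map_comp := fun f g => map_comp _ _ _ g.unop f.unop }
      (∃ adj : Spec.rightOp ⊣ globalSections Γ,
        ∀ T : TGSemi.{v, u} Γ, adj.unit.app T = toGlobalSections T) ∧
      ∀ T T' : TGSemi.{v, u} Γ, ∃ e : (affineSpec T ⟶ affineSpec T') ≃ (T' ⟶ T),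
        (∀ φ : T' ⟶ T, e.symm φ = affineSpecMap φ) ∧
        ∀ ψ : affineSpec T ⟶ affineSpec T',
          toGlobalSections T' ≫ (globalSections Γ).map ψ.op = e ψ ≫ toGlobalSections T := by
  refine ⟨affineSpecMap_id, fun _ _ _ f g => affineSpecMap_comp f g, ?_⟩
  intro Spec
  let E (T : TGSemi.{v, u} Γ) (X : (AffGamma.{v, u} Γ)ᵒᵖ) :
      (Spec.rightOp.obj T ⟶ X) ≃ (T ⟶ (globalSections Γ).obj X) :=
    (opEquiv (Spec.rightOp.obj T) X).trans
      (Equiv.ofBijective _ (bijective_comp_globalSections_map T X.unop))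
  have hE : ∀ (T : TGSemi.{v, u} Γ) (X : (AffGamma.{v, u} Γ)ᵒᵖ) (g : Spec.rightOp.obj T ⟶ X),
      E T X g = toGlobalSections T ≫ (globalSections Γ).map g := fun _ _ _ => rfl
  refine ⟨⟨Adjunction.mkOfHomEquiv
    { homEquiv := E
      homEquiv_naturality_left_symm := ?_
      homEquiv_naturality_right := ?_ }, ?_⟩, ?_⟩
  · intro T' T X f g
    rw [Equiv.symm_apply_eq, hE, Functor.map_comp, ← Category.assoc]
    -- Naturality is required for the inverse of `E`; writing the given homomorphism as a value of
    -- `E` reduces it to the naturality of `λ`.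
    obtain ⟨g, rfl⟩ := (E T X).surjective g
    rw [Equiv.symm_apply_apply, hE, ← Category.assoc]
    exact congrArg (· ≫ _) (toGlobalSections_naturality f).symm
  · intro T X Y f g
    rw [hE, hE, Functor.map_comp, Category.assoc]
  · intro T
    -- The unit is the image of the identity under the bijection, that is `λ_T` followed by the
    -- pullback along an identity.
    change E T _ (𝟙 _) = _
    exact (hE T _ _).trans ((congrArg _ ((globalSections Γ).map_id _)).trans (Category.comp_id _))
  · exact fun T T' => ⟨affineSpecHomEquiv T T', fun _ => rfl,
      fun ψ => (affineSpecHomEquiv_comp T T' ψ).symm⟩
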